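/- Let $\mathcal Y\subset\mathbb R$, $\mathcal X\subset\mathbb R^p$, and let $(Y,X)$ be a random element of $\mathcal Y\times\mathcal X$ with law $P$; let $P_X$ be the law of $X$. Let $s(y,x,\theta)\in\mathbb R^d$ be an estimating function and $f(x,\theta)\in\mathbb R^q$ a predictive estimating function, both (jointly) measurable; write $s_\theta=s(Y,X,\theta)$, $f_\theta=f(X,\theta)$. Let $\theta^*$ satisfy $\mathbb E\, s_{\theta^*}=0$. For each $n$, let $(y_i,x_i)$, $1\le i\le n$, be i.i.d. from $P$ (labeled data) and, independently of these, let $x_i$, $n<i\le n+N$, be i.i.d. from $P_X$ (unlabeled data), where $N=N_n$. Write $\mathbb E_n,\mathrm{Cov}_n$ for the mean and covariance (normalized by $1/n$) of the labeled sample. For an initial estimator $\hat\theta_0$, an estimator $\hat H$ of a matrix $H$, and $\gamma\in\mathbb R$ put $$\hat T(\theta)=\mathrm{Cov}_n(s_\theta,f_\theta)\{\mathrm{Cov}_n(f_\theta)\}^{-1},\qquad \hat S(\theta)=\frac1n\sum_{i=1}^n\Big[s(y_i,x_i,\theta)+\gamma\hat T(\theta)\Big\{f(x_i,\theta)-\frac1N\sum_{j=n+1}^{n+N}f(x_j,\theta)\Big\}\Big],$$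 $$\hat\theta_{pdc,1}=\hat\theta_0-\hat H^{-1}\hat S(\hat\theta_0).$$ Assume: (1) $\theta^*$ is an interior point of a compact set $\Theta\subset\mathbb R^d$; (2) $\|\hat\theta_0-\theta^*\|=O_p(n^{-1/2})$ and $\|\hat H-H\|=o_p(1)$, where $\theta\mapsto\mathbb E\,s_\theta$ is differentiable at $\theta^*$ with Jacobian matrix $H$; (3) $\mathbb E\|s_{\theta^*}\|^2<\infty$ and $\mathbb E\|f_{\theta^*}\|^2<\infty$; (4) $\mathrm{Cov}(f_{\theta^*})$ and $H$ are nonsingular; (5) there are a neighborhood $V$ of $\theta^*$ and measurable functions $\dot s(y,x)$, $\dot f(x)$ with $\mathbb E\,\dot s^2(Y,X)<\infty$, $\mathbb E\,\dot f^2(X)<\infty$ such that $\|s(y,x,\theta_1)-s(y,x,\theta_2)\|\le\dot s(y,x)\|\theta_1-\theta_2\|$ and $\|f(x,\theta_1)-f(x,\theta_2)\|\le\dot f(x)\|\theta_1-\theta_2\|$ for all $\theta_1,\theta_2\in V$, $y\in\mathcal Y$, $x\in\mathcal X$; (6) $N/(n+N)\to\eta$ for some constant $\eta\in(0,1]$ as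 $n\to\infty$. For $\gamma\in\mathbb R$ let $\Gamma(\gamma)=\mathrm{Cov}(s_{\theta^*})+(\gamma^2/\eta+2\gamma)\,\mathrm{Cov}(s_{\theta^*},f_{\theta^*})\{\mathrm{Cov}(f_{\theta^*})\}^{-1}\mathrm{Cov}(f_{\theta^*},s_{\theta^*})$, and $\gamma_{opt}=-\eta$. Then, with the data-driven choice $\gamma=-N/(n+N)$ in $\hat\theta_{pdc,1}$, $$\sqrt n(\hat\theta_{pdc,1}-\theta^*)\overset{D}{\to}N_d\big(0,\,H^{-1}\Gamma(\gamma_{opt})\{H^\top\}^{-1}\big),$$ where $$\Gamma(\gamma_{opt})=\mathrm{Cov}(s_{\theta^*})-\eta\,\mathrm{Cov}(s_{\theta^*},f_{\theta^*})\{\mathrm{Cov}(f_{\theta^*})\}^{-1}\mathrm{Cov}(f_{\theta^*},s_{\theta^*}).$$ The value $\gamma_{opt}$ is optimal: $H^{-1}\Gamma(\gamma)\{H^\top\}^{-1}-H^{-1}\Gamma(\gamma_{opt})\{H^\top\}^{-1}$ is positive semi-definite for every $\gamma\in\mathbb R$. Moreover the estimator is never less efficient than the supervised one: every $\sqrt n$-consistent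 estimator $\hat\theta_{sup}$ that satisfies $\frac1n\sum_{i=1}^n s(y_i,x_i,\hat\theta_{sup})=0$ with probability tending to one has $\sqrt n(\hat\theta_{sup}-\theta^*)\overset{D}{\to}N_d(0,H^{-1}\mathrm{Cov}(s_{\theta^*})\{H^\top\}^{-1})$, and $H^{-1}\mathrm{Cov}(s_{\theta^*})\{H^\top\}^{-1}-H^{-1}\Gamma(\gamma_{opt})\{H^\top\}^{-1}$ is positive semi-definite. -/

import Mathlib

open MeasureTheory ProbabilityTheory Filter Topology

noncomputable section

namespace PDC

/-- The Euclidean space `ℝᵏ`, with the `L₂` norm. -/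
abbrev Vec (k : ℕ) : Type := EuclideanSpace ℝ (Fin k)

/-- The product `A v` of a (possibly rectangular) matrix and a vector. -/
def mulVec {k l : ℕ} (A : Matrix (Fin k) (Fin l) ℝ) (v : Vec l) : Vec k :=
  WithLp.toLp 2 (A.mulVec v.ofLp)

/-- The sample mean `m⁻¹ ∑ᵢ vᵢ`. -/
def sampleMean {m k : ℕ} (v : Fin m → Vec k) : Vec k :=
  (m : ℝ)⁻¹ • ∑ i, v i

/-- The sample cross-covariance matrix `m⁻¹ ∑ᵢ (uᵢ - ū)(vᵢ - v̄)ᵀ`. -/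
def sampleCov {m k l : ℕ} (u : Fin m → Vec k) (v : Fin m → Vec l) :
    Matrix (Fin k) (Fin l) ℝ :=
  Matrix.of fun a b =>
    (m : ℝ)⁻¹ * ∑ i, (u i a - sampleMean u a) * (v i b - sampleMean v b)

/-- The population cross-covariance matrix `Cov(g, h)` of two random vectors. -/
def covMat {α : Type*} [MeasurableSpace α] {k l : ℕ} (P : Measure α)
    (g : α → Vec k) (h : α → Vec l) : Matrix (Fin k) (Fin l) ℝ :=
  Matrix.of fun a b => covariance (fun z => g z a) (fun z => h z b) P

section Estimator

variable {𝒴 𝒳 : Type*} {d q n N : ℕ}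

/-- The sample least squares coefficient matrix
`T̂(θ) = Covₙ(s_θ, f_θ) {Covₙ(f_θ)}⁻¹`, computed from the labeled sample `(yᵢ, xᵢ)`. -/
def That (s : 𝒴 → 𝒳 → Vec d → Vec d) (f : 𝒳 → Vec d → Vec q)
    (y : Fin n → 𝒴) (x : Fin n → 𝒳) (θ : Vec d) : Matrix (Fin d) (Fin q) ℝ :=
  sampleCov (fun i => s (y i) (x i) θ) (fun i => f (x i) θ) *
    (sampleCov (fun i => f (x i) θ) (fun i => f (x i) θ))⁻¹

/-- The prediction de-correlated estimating function
`Ŝ(θ) = n⁻¹ ∑ᵢ [s(yᵢ, xᵢ, θ) + γ T̂(θ) {f(xᵢ, θ) - N⁻¹ ∑ⱼ f(x'ⱼ, θ)}]`, where `(yᵢ, xᵢ)` is the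
labeled and `x'ⱼ` the unlabeled sample. -/
def Shat (s : 𝒴 → 𝒳 → Vec d → Vec d) (f : 𝒳 → Vec d → Vec q) (γ : ℝ)
    (y : Fin n → 𝒴) (x : Fin n → 𝒳) (x' : Fin N → 𝒳) (θ : Vec d) : Vec d :=
  sampleMean fun i => s (y i) (x i) θ +
    γ • mulVec (That s f y x θ) (f (x i) θ - sampleMean fun j => f (x' j) θ)

/-- The one-step estimator `θ̂₀ - Ĥ⁻¹ Ŝ(θ̂₀)`. -/
def thetaPDC (s : 𝒴 → 𝒳 → Vec d → Vec d) (f : 𝒳 → Vec d → Vec q) (γ : ℝ)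
    (y : Fin n → 𝒴) (x : Fin n → 𝒳) (x' : Fin N → 𝒳)
    (θ₀ : Vec d) (Hhat : Matrix (Fin d) (Fin d) ℝ) : Vec d :=
  θ₀ - mulVec Hhat⁻¹ (Shat s f γ y x x' θ₀)

end Estimator

section Population

variable {𝒴 𝒳 : Type*} [MeasurableSpace 𝒴] [MeasurableSpace 𝒳] {d q : ℕ}

/-- `Cov(s_θ)`, for `(Y, X)` with law `P`. -/
def covS (P : Measure (𝒴 × 𝒳)) (s : 𝒴 → 𝒳 → Vec d → Vec d) (θ : Vec d) :
    Matrix (Fin d) (Fin d) ℝ :=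
  covMat P (fun z => s z.1 z.2 θ) (fun z => s z.1 z.2 θ)

/-- `Cov(s_θ, f_θ)`. -/
def covSF (P : Measure (𝒴 × 𝒳)) (s : 𝒴 → 𝒳 → Vec d → Vec d) (f : 𝒳 → Vec d → Vec q)
    (θ : Vec d) : Matrix (Fin d) (Fin q) ℝ :=
  covMat P (fun z => s z.1 z.2 θ) (fun z => f z.2 θ)

/-- `Cov(f_θ, s_θ)`. -/
def covFS (P : Measure (𝒴 × 𝒳)) (s : 𝒴 → 𝒳 → Vec d → Vec d) (f : 𝒳 → Vec d → Vec q)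
    (θ : Vec d) : Matrix (Fin q) (Fin d) ℝ :=
  covMat P (fun z => f z.2 θ) (fun z => s z.1 z.2 θ)

/-- `Cov(f_θ)`. -/
def covF (P : Measure (𝒴 × 𝒳)) (f : 𝒳 → Vec d → Vec q) (θ : Vec d) :
    Matrix (Fin q) (Fin q) ℝ :=
  covMat P (fun z => f z.2 θ) (fun z => f z.2 θ)

/-- `Γ(γ) = Cov(s_θ) + (γ² / η + 2γ) Cov(s_θ, f_θ) {Cov(f_θ)}⁻¹ Cov(f_θ, s_θ)`. -/
def Gam (P : Measure (𝒴 × 𝒳)) (s : 𝒴 → 𝒳 → Vec d → Vec d) (f : 𝒳 → Vec d → Vec q)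
    (θ : Vec d) (η γ : ℝ) : Matrix (Fin d) (Fin d) ℝ :=
  covS P s θ + (γ ^ 2 / η + 2 * γ) • (covSF P s f θ * (covF P f θ)⁻¹ * covFS P s f θ)

end Population

/-- `H⁻¹ G {Hᵀ}⁻¹`. -/
def sandwich {d : ℕ} (H G : Matrix (Fin d) (Fin d) ℝ) : Matrix (Fin d) (Fin d) ℝ :=
  H⁻¹ * G * (H.transpose)⁻¹

section Stochastic

variable {Ω : ℕ → Type*} [∀ n, MeasurableSpace (Ω n)]

/-- `Wₙ = o_p(1)`. -/
def IsLittleOpOne (μ : ∀ n, Measure (Ω n)) (W : ∀ n, Ω n → ℝ) : Prop :=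
  ∀ ε : ℝ, 0 < ε → Tendsto (fun n => μ n {ω | ε < |W n ω|}) atTop (𝓝 0)

/-- `Wₙ = O_p(rₙ)`. -/
def IsBigOp (μ : ∀ n, Measure (Ω n)) (W : ∀ n, Ω n → ℝ) (r : ℕ → ℝ) : Prop :=
  ∀ ε : ℝ, 0 < ε → ∃ M : ℝ, ∀ᶠ n in atTop, μ n {ω | M * r n < |W n ω|} ≤ ENNReal.ofReal ε

/-- `‖θ̂ₙ - θ‖ = O_p(n^{-1/2})`. -/
def RootNConsistent {d : ℕ} (μ : ∀ n, Measure (Ω n)) (θhat : ∀ n, Ω n → Vec d)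
    (θ : Vec d) : Prop :=
  IsBigOp μ (fun n ω => ‖θhat n ω - θ‖) (fun n : ℕ => (Real.sqrt (n : ℝ))⁻¹)

/-- `√n (θ̂ₙ - θ)` converges in distribution to `N_d(0, V)` (and `V` is a covariance matrix). -/
def AsympNormal {d : ℕ} (μ : ∀ n, Measure (Ω n)) [∀ n, IsProbabilityMeasure (μ n)]
    (θhat : ∀ n, Ω n → Vec d) (θ : Vec d) (V : Matrix (Fin d) (Fin d) ℝ) : Prop :=
  V.PosSemidef ∧
    TendstoInDistribution (fun (n : ℕ) ω => Real.sqrt (n : ℝ) • (θhat n ω - θ)) atTop id μ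
      (multivariateGaussian 0 V)

end Stochastic

end PDC

end

/-! Write T = Cov(s,f) Cov(f)⁻¹, all at θ*. The crux is asymptotic linearity of the one-step
estimator (`tendsto_thetaPDC_linearization`): √n(θ̂ - θ*) equals -H⁻¹ {√n Eₙs + γ₀ T √n(Eₙf - E_N
f)} up to o_p(1), with s and f evaluated at θ* and γ₀ = -η. Replacing θ̂₀ by θ* inside the sample
means costs only their drift, by stochastic equicontinuity (`IsIIDArray.equicontinuity`). The drift
of the score is H √n(θ̂₀ - θ*), which the Newton step cancels. The drift of f is common to both
samples and drops out of the difference, so the mean of f need not be differentiable. Since Ĥ⁻¹, T̂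
and the data-driven γ multiply terms that are O_p(1), their consistency suffices.

The linear term is built from two independent i.i.d. samples, with √(n/N) tending to √((1-η)/η). In
a direction τ, with w = Tᵀτ, the labeled sample contributes Var(τᵀs - η wᵀf) and the unlabeled one
η²(1-η)/η · Var(wᵀf). Because w solves the normal equations, the sum is the quadratic form of Γ(-η)
(`dotProduct_Gam_opt`). Optimality is a completed square: Γ(γ) - Γ(-η) is (γ+η)²/η times the
positive semidefinite matrix T Cov(f,s). The comparison with the supervised estimator is the case γ
= 0.

Statements in probability become limits along the filter `whp μ` on `Σ n, Ω n`, so that the usual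
calculus of `Tendsto` applies. Convergence in distribution is proved through characteristic
functions, one direction t at a time. -/

noncomputable section

namespace PDC

/-! ### Stochastic order calculus as filter calculus. -/

section Calculus

variable {Ω : ℕ → Type*} [∀ n, MeasurableSpace (Ω n)]

/-- The filter of events whose probability tends to one. -/
def whp (μ : ∀ n, Measure (Ω n)) : Filter (Σ n, Ω n) where
  -- The exceptional sets need not be measurable: `μ n` acts as an outer measure, and the filter
  -- axioms use only monotonicity and subadditivity.
  sets := {S | Tendsto (fun n => μ n {ω | (⟨n, ω⟩ : Σ n, Ω n) ∉ S}) atTop (𝓝 0)}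
  univ_sets := by simp
  sets_of_superset {S T} hS hST := tendsto_of_tendsto_of_tendsto_of_le_of_le tendsto_const_nhds hS
    (fun _ => zero_le) (fun n => measure_mono fun ω hω h => hω (hST h))
  inter_sets {S T} hS hT := by
    have h := Tendsto.add hS hT
    rw [add_zero] at h
    refine tendsto_of_tendsto_of_tendsto_of_le_of_le tendsto_const_nhds h
      (fun _ => zero_le) (fun n => ?_)
    refine (measure_mono ?_).trans (measure_union_le _ _)
    intro ω hω
    by_contra hc
    simp only [Set.mem_union, Set.mem_ofPred_eq, not_or, not_not] at hc
    exact hω hc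

variable {μ : ∀ n, Measure (Ω n)}

lemma mem_whp {S : Set (Σ n, Ω n)} :
    S ∈ whp μ ↔ Tendsto (fun n => μ n {ω | (⟨n, ω⟩ : Σ n, Ω n) ∉ S}) atTop (𝓝 0) := Iff.rfl

/-- For n ≥ b the exceptional event is empty. This turns every property holding for all large n into
one holding along `whp μ`. -/
lemma tendsto_fst_whp : Tendsto (fun z : Σ n, Ω n => z.1) (whp μ) atTop := by
  refine tendsto_atTop.2 fun b => ?_
  refine mem_whp.2 (tendsto_const_nhds.congr' ?_)
  filter_upwards [eventually_ge_atTop b] with n hn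
  simp [hn]

/-- A sequence of random vectors that is bounded in probability. -/
def BddP {F : Type*} [Norm F] (μ : ∀ n, Measure (Ω n)) (W : (Σ n, Ω n) → F) : Prop :=
  ∀ ε : ℝ, 0 < ε → ∃ M : ℝ, ∀ᶠ n in atTop,
    μ n {ω | M < ‖W ⟨n, ω⟩‖} ≤ ENNReal.ofReal ε

lemma mem_whp_iff_real {S : Set (Σ n, Ω n)} :
    S ∈ whp μ ↔ ∀ ε : ℝ, 0 < ε → ∀ᶠ n in atTop,
      μ n {ω | (⟨n, ω⟩ : Σ n, Ω n) ∉ S} ≤ ENNReal.ofReal ε := by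
  rw [mem_whp, ENNReal.tendsto_nhds_zero]
  constructor
  · intro h ε hε
    exact h _ (ENNReal.ofReal_pos.2 hε)
  · intro h ε hε
    rcases eq_or_ne ε ⊤ with rfl | ht
    · simp
    · have := h ε.toReal (ENNReal.toReal_pos hε.ne' ht)
      rwa [ENNReal.ofReal_toReal ht] at this

/-- To show that an event has probability tending to one, one may work on the events where a
given bounded-in-probability sequence is bounded by a constant. -/
lemma BddP.mem_whp {F : Type*} [Norm F] {W : (Σ n, Ω n) → F} (hW : BddP μ W)
    {T : Set (Σ n, Ω n)} (h : ∀ M : ℝ, ∀ᶠ z in whp μ, ‖W z‖ ≤ M → z ∈ T) : T ∈ whp μ := by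
  rw [mem_whp_iff_real]
  intro ε hε
  obtain ⟨M, hM⟩ := hW (ε / 2) (by positivity)
  have h2 := mem_whp_iff_real.1 (h M) (ε / 2) (by positivity)
  filter_upwards [hM, h2] with n h1 h2
  calc μ n {ω | (⟨n, ω⟩ : Σ n, Ω n) ∉ T}
      ≤ μ n ({ω | M < ‖W ⟨n, ω⟩‖} ∪ {ω | (⟨n, ω⟩ : Σ n, Ω n) ∉ {z | ‖W z‖ ≤ M → z ∈ T}}) := by
        refine measure_mono fun ω hω => ?_
        by_contra hc
        simp only [Set.mem_union, Set.mem_ofPred_eq, not_or, not_not, not_lt] at hc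
        exact hω (hc.2 hc.1)
    _ ≤ _ := (measure_union_le _ _).trans (add_le_add h1 h2)
    _ = ENNReal.ofReal ε := by
        rw [← ENNReal.ofReal_add (by positivity) (by positivity), add_halves]

lemma BddP.mono' {F G : Type*} [Norm F] [Norm G] {W : (Σ n, Ω n) → F} {W' : (Σ n, Ω n) → G}
    (hW : BddP μ W) {C : ℝ} (hC : 0 ≤ C) (h : ∀ᶠ z in whp μ, ‖W' z‖ ≤ C * ‖W z‖) :
    BddP μ W' := by
  intro ε hε
  obtain ⟨M, hM⟩ := hW (ε / 2) (by positivity)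
  have h2 := mem_whp_iff_real.1 h (ε / 2) (by positivity)
  refine ⟨C * M, ?_⟩
  filter_upwards [hM, h2] with n h1 h2
  calc μ n {ω | C * M < ‖W' ⟨n, ω⟩‖}
      ≤ μ n ({ω | M < ‖W ⟨n, ω⟩‖} ∪
          {ω | (⟨n, ω⟩ : Σ n, Ω n) ∉ {z | ‖W' z‖ ≤ C * ‖W z‖}}) := by
        refine measure_mono fun ω hω => ?_
        by_contra hc
        simp only [Set.mem_union, Set.mem_ofPred_eq, not_or, not_not, not_lt] at hc
        exact absurd hω (not_lt.2 (hc.2.trans (mul_le_mul_of_nonneg_left hc.1 hC)))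
    _ ≤ _ := (measure_union_le _ _).trans (add_le_add h1 h2)
    _ = ENNReal.ofReal ε := by
        rw [← ENNReal.ofReal_add (by positivity) (by positivity), add_halves]

lemma BddP.add {F : Type*} [SeminormedAddCommGroup F] {W W' : (Σ n, Ω n) → F}
    (hW : BddP μ W) (hW' : BddP μ W') : BddP μ (fun z => W z + W' z) := by
  intro ε hε
  obtain ⟨M, hM⟩ := hW (ε / 2) (by positivity)
  obtain ⟨M', hM'⟩ := hW' (ε / 2) (by positivity)
  refine ⟨M + M', ?_⟩
  filter_upwards [hM, hM'] with n h1 h2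
  calc μ n {ω | M + M' < ‖W ⟨n, ω⟩ + W' ⟨n, ω⟩‖}
      ≤ μ n ({ω | M < ‖W ⟨n, ω⟩‖} ∪ {ω | M' < ‖W' ⟨n, ω⟩‖}) := by
        refine measure_mono fun ω hω => ?_
        by_contra hc
        simp only [Set.mem_union, Set.mem_ofPred_eq, not_or, not_lt] at hc
        exact absurd hω (not_lt.2 ((norm_add_le _ _).trans (add_le_add hc.1 hc.2)))
    _ ≤ _ := (measure_union_le _ _).trans (add_le_add h1 h2)
    _ = ENNReal.ofReal ε := by
        rw [← ENNReal.ofReal_add (by positivity) (by positivity), add_halves]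

lemma bddP_zero {F : Type*} [SeminormedAddCommGroup F] : BddP μ (fun _ => (0 : F)) :=
  fun ε _ => ⟨0, by simp⟩

lemma BddP.sum {F ι : Type*} [SeminormedAddCommGroup F] (I : Finset ι) {W : ι → (Σ n, Ω n) → F}
    (hW : ∀ i ∈ I, BddP μ (W i)) : BddP μ (fun z => ∑ i ∈ I, W i z) := by
  classical
  induction I using Finset.induction_on with
  | empty => simpa using bddP_zero
  | insert a I ha ih =>
    simp only [Finset.sum_insert ha]
    exact (hW a (by simp)).add (ih fun i hi => hW i (by simp [hi]))

lemma BddP.pi {k : ℕ} {W : (Σ n, Ω n) → Vec k} (hW : ∀ a, BddP μ (fun z => W z a)) :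
    BddP μ W := by
  have h : BddP μ fun z => ∑ a, ‖W z a‖ := by
    refine BddP.sum _ fun a _ => (hW a).mono' (C := 1) zero_le_one ?_
    simp
  refine h.mono' (C := 1) zero_le_one (.of_forall fun z => ?_)
  rw [one_mul, Real.norm_of_nonneg (by positivity), EuclideanSpace.norm_eq]
  rw [Real.sqrt_le_left (by positivity)]
  exact Finset.sum_sq_le_sq_sum_of_nonneg fun i _ => norm_nonneg _

/-- `O_p(1) o_p(1) = o_p(1)`. -/
lemma BddP.tendsto_mul {F : Type*} [SeminormedAddCommGroup F] {W : (Σ n, Ω n) → F} (hW : BddP μ W)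
    {a : (Σ n, Ω n) → ℝ} (ha : Tendsto a (whp μ) (𝓝 0)) :
    Tendsto (fun z => a z * ‖W z‖) (whp μ) (𝓝 0) := by
  rw [Metric.tendsto_nhds]
  intro ε hε
  refine hW.mem_whp fun M => ?_
  have hM : 0 < |M| + 1 := by positivity
  filter_upwards [Metric.tendsto_nhds.1 ha (ε / (|M| + 1)) (by positivity)] with z hz hzM
  rw [dist_zero_right, Real.norm_eq_abs, lt_div_iff₀ hM] at hz
  rw [dist_zero_right, norm_mul, norm_norm, Real.norm_eq_abs]
  exact lt_of_le_of_lt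
    (mul_le_mul_of_nonneg_left (by linarith [le_abs_self M]) (abs_nonneg _)) hz

lemma tendsto_whp_of_isLittleOpOne {W : ∀ n, Ω n → ℝ} (h : IsLittleOpOne μ W) :
    Tendsto (fun z : Σ n, Ω n => W z.1 z.2) (whp μ) (𝓝 0) := by
  rw [Metric.tendsto_nhds]
  intro ε hε
  refine mem_whp.2 ?_
  -- The exceptional event is `ε ≤ |W|`, whereas `IsLittleOpOne` controls a strict inequality;
  -- halving ε bridges the two.
  refine tendsto_of_tendsto_of_tendsto_of_le_of_le tendsto_const_nhds (h (ε / 2) (by positivity))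
    (fun _ => zero_le) (fun n => measure_mono fun ω hω => ?_)
  simp only [Set.mem_ofPred_eq, dist_zero_right, not_lt, Real.norm_eq_abs] at hω ⊢
  linarith

lemma RootNConsistent.bddP {d : ℕ} {θhat : ∀ n, Ω n → Vec d} {θ : Vec d}
    (h : RootNConsistent μ θhat θ) :
    BddP μ (fun z => Real.sqrt (z.1 : ℝ) • (θhat z.1 z.2 - θ)) := by
  intro ε hε
  obtain ⟨M, hM⟩ := h ε hε
  refine ⟨M, ?_⟩
  filter_upwards [hM, eventually_gt_atTop 0] with n hn h0
  refine (measure_mono fun ω hω => ?_).trans hn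
  have hs : 0 < Real.sqrt (n : ℝ) := Real.sqrt_pos.2 (by exact_mod_cast h0)
  simp only [Set.mem_ofPred_eq, norm_smul, Real.norm_eq_abs, abs_norm, abs_of_pos hs] at hω ⊢
  rwa [mul_inv_lt_iff₀ hs, mul_comm]

lemma RootNConsistent.tendsto {d : ℕ} {θhat : ∀ n, Ω n → Vec d} {θ : Vec d}
    (h : RootNConsistent μ θhat θ) :
    Tendsto (fun z : Σ n, Ω n => θhat z.1 z.2) (whp μ) (𝓝 θ) := by
  rw [tendsto_iff_norm_sub_tendsto_zero]
  have h0 : Tendsto (fun z : Σ n, Ω n => (Real.sqrt (z.1 : ℝ))⁻¹) (whp μ) (𝓝 0) :=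
    (tendsto_inv_atTop_zero.comp (Real.tendsto_sqrt_atTop.comp
      tendsto_natCast_atTop_atTop)).comp tendsto_fst_whp
  refine (h.bddP.tendsto_mul h0).congr' ?_
  filter_upwards [tendsto_fst_whp.eventually_gt_atTop 0] with z hz
  have hs : 0 < Real.sqrt (z.1 : ℝ) := Real.sqrt_pos.2 (by exact_mod_cast hz)
  rw [norm_smul, Real.norm_of_nonneg hs.le]
  field_simp

/-- Multiplying a bounded-in-probability vector by a matrix that tends to zero. -/
lemma BddP.tendsto_mulVec {k l : ℕ} {W : (Σ n, Ω n) → Vec l} (hW : BddP μ W)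
    {A : (Σ n, Ω n) → Matrix (Fin k) (Fin l) ℝ} (hA : Tendsto A (whp μ) (𝓝 0)) :
    Tendsto (fun z => mulVec (A z) (W z)) (whp μ) (𝓝 0) := by
  have hc : ∀ a, Tendsto (fun z => mulVec (A z) (W z) a) (whp μ) (𝓝 0) := by
    intro a
    have : Tendsto (fun z => ∑ b, A z a b * W z b) (whp μ) (𝓝 (∑ _b : Fin l, 0)) := by
      refine tendsto_finsetSum _ fun b _ => ?_
      have hab : Tendsto (fun z => |A z a b|) (whp μ) (𝓝 0) := by
        have := ((tendsto_pi_nhds.1 ((tendsto_pi_nhds.1 hA) a)) b).abs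
        simpa using this
      refine squeeze_zero_norm (fun z => ?_) (hW.tendsto_mul hab)
      rw [norm_mul, Real.norm_eq_abs]
      exact mul_le_mul_of_nonneg_left (PiLp.norm_apply_le _ _) (abs_nonneg _)
    rw [Finset.sum_const_zero] at this
    exact this
  have h2 : Tendsto (fun z => (mulVec (A z) (W z)).ofLp) (whp μ) (𝓝 0) :=
    tendsto_pi_nhds.2 fun a => hc a
  exact ((PiLp.continuous_toLp 2 _).tendsto _).comp h2

end Calculus

/-! ### Law of large numbers, Chebyshev bounds and central limit theorem for i.i.d. arrays. -/

section Arrays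

variable {Ω : ℕ → Type*} [∀ n, MeasurableSpace (Ω n)] {μ : ∀ n, Measure (Ω n)}
  {E E' : Type*} [MeasurableSpace E] [MeasurableSpace E'] {Q : Measure E}
  {m : ℕ → ℕ} {Z : ∀ n, Fin (m n) → Ω n → E}

/-- For each `n`, an i.i.d. sample of size `m n` with law `Q`. -/
structure IsIIDArray (μ : ∀ n, Measure (Ω n)) (m : ℕ → ℕ) (Z : ∀ n, Fin (m n) → Ω n → E)
    (Q : Measure E) : Prop where
  law : ∀ n i, HasLaw (Z n i) Q (μ n)
  indep : ∀ n, iIndepFun (Z n) (μ n)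

lemma IsIIDArray.comp (h : IsIIDArray μ m Z Q) {g : E → E'} (hg : AEMeasurable g Q) :
    IsIIDArray μ m (fun n i ω => g (Z n i ω)) (Q.map g) where
  law n i := HasLaw.fun_comp ⟨hg, rfl⟩ (h.law n i)
  indep n := (h.indep n).comp₀ (fun _ => g) (fun i => (h.law n i).aemeasurable)
    (fun i => by rw [(h.law n i).map_eq]; exact hg)

/-- Both samples have the product measure as joint law. Hence limit theorems about one infinite
sequence transfer to arrays whose probability spaces change with n. -/
lemma map_sum_eq_of_iid {Ω₁ Ω₂ : Type*} [MeasurableSpace Ω₁] [MeasurableSpace Ω₂]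
    {μ₁ : Measure Ω₁} {μ₂ : Measure Ω₂} [IsProbabilityMeasure μ₁] [IsProbabilityMeasure μ₂]
    {ν : Measure ℝ} [IsProbabilityMeasure ν]
    {k : ℕ} {ξ : Fin k → Ω₁ → ℝ} {ζ : ℕ → Ω₂ → ℝ}
    (hξ : ∀ i, HasLaw (ξ i) ν μ₁) (hξi : iIndepFun ξ μ₁)
    (hζ : ∀ i, HasLaw (ζ i) ν μ₂) (hζi : iIndepFun ζ μ₂) :
    μ₁.map (fun ω => ∑ i, ξ i ω) = μ₂.map (fun ω => ∑ i ∈ Finset.range k, ζ i ω) := by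
  have h1 : HasLaw (fun ω i => ξ i ω) (Measure.pi fun _ : Fin k => ν) μ₁ := hξi.hasLaw_pi hξ
  have h2 : HasLaw (fun ω (i : Fin k) => ζ i ω) (Measure.pi fun _ : Fin k => ν) μ₂ :=
    (hζi.precomp Fin.val_injective).hasLaw_pi fun i => hζ i
  have hm : Measurable fun v : Fin k → ℝ => ∑ i, v i := by fun_prop
  have e1 := AEMeasurable.map_map_of_aemeasurable hm.aemeasurable h1.aemeasurable
  have e2 := AEMeasurable.map_map_of_aemeasurable hm.aemeasurable h2.aemeasurable
  rw [h1.map_eq] at e1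
  rw [h2.map_eq] at e2
  simp only [Finset.sum_range]
  exact e1.symm.trans e2

variable [∀ n, IsProbabilityMeasure (μ n)]

/-- Convergence in probability to a constant depends only on the law of each sum, so the strong law
for a single i.i.d. sequence with law `ν`, sampled along `m`, is enough. -/
lemma IsIIDArray.tendsto_mean_real {ν : Measure ℝ} [IsProbabilityMeasure ν]
    {ξ : ∀ n, Fin (m n) → Ω n → ℝ}
    (h : IsIIDArray μ m ξ ν) (hint : Integrable id ν) (hm : Tendsto m atTop atTop) :
    Tendsto (fun z : Σ n, Ω n => (m z.1 : ℝ)⁻¹ * ∑ i, ξ z.1 i z.2) (whp μ) (𝓝 (∫ x, x ∂ν)) := by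
  obtain ⟨Ω', _, P', ζ, -, hζ, hζi, hP'⟩ := exists_iid ℕ ν
  have hid : ∀ i, IdentDistrib (ζ i) (ζ 0) P' P' := fun i =>
    ⟨(hζ i).aemeasurable, (hζ 0).aemeasurable, by rw [(hζ i).map_eq, (hζ 0).map_eq]⟩
  have hint0 : Integrable (ζ 0) P' := by
    have : Integrable id (P'.map (ζ 0)) := by rwa [(hζ 0).map_eq]
    exact this.comp_aemeasurable (hζ 0).aemeasurable
  have hsl := strong_law_ae_real ζ hint0 (fun i j hij => hζi.indepFun hij) hid
  rw [(hζ 0).integral_eq] at hsl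
  have hmeas : ∀ n : ℕ, AEMeasurable (fun ω => (∑ i ∈ Finset.range n, ζ i ω)) P' :=
    fun n => Finset.aemeasurable_fun_sum _ fun i _ => (hζ i).aemeasurable
  have htm := (tendstoInMeasure_of_tendsto_ae
    (fun n => ((hmeas n).div_const (n : ℝ)).aestronglyMeasurable) hsl).comp hm
  rw [tendstoInMeasure_iff_dist] at htm
  rw [Metric.tendsto_nhds]
  intro ε hε
  refine mem_whp.2 ((htm ε hε).congr fun n => ?_)
  have hS : MeasurableSet {x : ℝ | ε ≤ dist (x / m n) (∫ x, x ∂ν)} :=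
    measurableSet_le measurable_const (by fun_prop)
  have e := congrArg (fun ρ => ρ {x : ℝ | ε ≤ dist (x / m n) (∫ x, x ∂ν)})
    (map_sum_eq_of_iid (h.law n) (h.indep n) hζ hζi)
  beta_reduce at e
  rw [Measure.map_apply_of_aemeasurable
    (Finset.aemeasurable_fun_sum _ fun i _ => (h.law n i).aemeasurable) hS,
    Measure.map_apply_of_aemeasurable (hmeas _) hS] at e
  simpa [div_eq_inv_mul] using e.symm

/-- Weak law of large numbers for arrays. -/
lemma IsIIDArray.tendsto_mean [IsProbabilityMeasure Q] (h : IsIIDArray μ m Z Q) {g : E → ℝ}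
    (hg : Integrable g Q) (hm : Tendsto m atTop atTop) :
    Tendsto (fun z : Σ n, Ω n => (m z.1 : ℝ)⁻¹ * ∑ i, g (Z z.1 i z.2)) (whp μ)
      (𝓝 (∫ x, g x ∂Q)) := by
  have hga := hg.aestronglyMeasurable.aemeasurable
  have : IsProbabilityMeasure (Q.map g) := Measure.isProbabilityMeasure_map hga
  have h1 := (h.comp hga).tendsto_mean_real
    ((integrable_map_measure aestronglyMeasurable_id hga).2 hg) hm
  have e : ∫ x, x ∂(Q.map g) = ∫ x, g x ∂Q := integral_map hga aestronglyMeasurable_id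
  rwa [e] at h1

omit [∀ n, IsProbabilityMeasure (μ n)] in
lemma IsIIDArray.memLp (h : IsIIDArray μ m Z Q) {g : E → ℝ} (hg : MemLp g 2 Q) (n : ℕ)
    (i : Fin (m n)) : MemLp (fun ω => g (Z n i ω)) 2 (μ n) := by
  have : MemLp g 2 ((μ n).map (Z n i)) := by rwa [(h.law n i).map_eq]
  exact this.comp_of_map (h.law n i).aemeasurable

/-- The scale `a` may grow with n in applications. The variance is relaxed to the second moment so
that pointwise envelope bounds on `g` can be inserted directly. -/
lemma IsIIDArray.chebyshev [IsProbabilityMeasure Q] (h : IsIIDArray μ m Z Q) {g : E → ℝ}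
    (hg : MemLp g 2 Q) {n : ℕ} (hn : 0 < m n) {a c : ℝ} (hc : 0 < c) :
    μ n {ω | c ≤ |a * ((m n : ℝ)⁻¹ * ∑ i, g (Z n i ω) - ∫ x, g x ∂Q)|} ≤
      ENNReal.ofReal (a ^ 2 * ((m n : ℝ)⁻¹ * ∫ x, g x ^ 2 ∂Q) / c ^ 2) := by
  have hmn : (m n : ℝ) ≠ 0 := by exact_mod_cast hn.ne'
  have hL := h.memLp hg n
  have hmean : ∀ i, ∫ ω, g (Z n i ω) ∂(μ n) = ∫ x, g x ∂Q := fun i =>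
    (h.law n i).integral_comp hg.aestronglyMeasurable
  have hvar : ∀ i, Var[fun ω => g (Z n i ω); μ n] = Var[g; Q] := fun i => by
    rw [← covariance_self (hL i).aemeasurable, ← covariance_self hg.aemeasurable]
    exact (h.law n i).covariance_fun_comp hg.aemeasurable hg.aemeasurable
  have hsum : MemLp (fun ω => ∑ i, g (Z n i ω)) 2 (μ n) := memLp_finsetSum _ fun i _ => hL i
  have hX : MemLp (fun ω => a * ((m n : ℝ)⁻¹ * ∑ i, g (Z n i ω))) 2 (μ n) :=
    (hsum.const_mul _).const_mul _
  have hEX : ∫ ω, a * ((m n : ℝ)⁻¹ * ∑ i, g (Z n i ω)) ∂(μ n) = a * ∫ x, g x ∂Q := by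
    rw [integral_const_mul, integral_const_mul,
      integral_finsetSum _ fun i _ => (hL i).integrable (by norm_num)]
    simp only [hmean, Finset.sum_const, Finset.card_univ, Fintype.card_fin, nsmul_eq_mul]
    field_simp
  have hVX : Var[fun ω => a * ((m n : ℝ)⁻¹ * ∑ i, g (Z n i ω)); μ n]
      = a ^ 2 * ((m n : ℝ)⁻¹ * Var[g; Q]) := by
    rw [variance_const_mul, variance_const_mul]
    have h1 := IndepFun.variance_sum (μ := μ n) (s := Finset.univ)
      (X := fun i ω => g (Z n i ω)) (fun i _ => hL i)
      (fun i _ j _ hij => ((h.comp hg.aemeasurable).indep n).indepFun hij)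
    have h2 : (∑ i, fun ω => g (Z n i ω)) = fun ω => ∑ i, g (Z n i ω) := by
      ext ω; simp
    rw [h2] at h1
    rw [h1]
    simp only [hvar, Finset.sum_const, Finset.card_univ, Fintype.card_fin, nsmul_eq_mul]
    field_simp
  have hle : Var[g; Q] ≤ ∫ x, g x ^ 2 ∂Q := variance_le_expectation_sq hg.aestronglyMeasurable
  have key := meas_ge_le_variance_div_sq hX hc
  rw [hEX, hVX] at key
  simp only [← mul_sub] at key
  refine key.trans (ENNReal.ofReal_le_ofReal ?_)
  gcongr

/-- Weak law for triangular arrays, under second moments that are negligible relative to the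
sample size. -/
lemma IsIIDArray.tendsto_centered_mean [IsProbabilityMeasure Q] (h : IsIIDArray μ m Z Q)
    (hm : Tendsto m atTop atTop) {φ : ℕ → E → ℝ} {a : ℕ → ℝ} {C : ℝ}
    (hφ : ∀ᶠ n in atTop, MemLp (φ n) 2 Q)
    (hC : ∀ᶠ n in atTop, a n ^ 2 * ∫ x, φ n x ^ 2 ∂Q ≤ C) :
    Tendsto (fun z : Σ n, Ω n => a z.1 *
      ((m z.1 : ℝ)⁻¹ * ∑ i, φ z.1 (Z z.1 i z.2) - ∫ x, φ z.1 x ∂Q)) (whp μ) (𝓝 0) := by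
  rw [Metric.tendsto_nhds]
  intro ε hε
  refine mem_whp.2 ?_
  have hlim : Tendsto (fun n => ENNReal.ofReal ((m n : ℝ)⁻¹ * (C / ε ^ 2))) atTop (𝓝 0) := by
    have : Tendsto (fun n => (m n : ℝ)⁻¹ * (C / ε ^ 2)) atTop (𝓝 (0 * (C / ε ^ 2))) :=
      (tendsto_inv_atTop_zero.comp (tendsto_natCast_atTop_atTop.comp hm)).mul_const _
    rw [zero_mul] at this
    simpa using ENNReal.tendsto_ofReal this
  refine tendsto_of_tendsto_of_tendsto_of_le_of_le' tendsto_const_nhds hlim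
    (.of_forall fun _ => zero_le) ?_
  filter_upwards [hφ, hC, hm.eventually_gt_atTop 0] with n h1 h2 h3
  have := h.chebyshev h1 h3 (a := a n) hε
  refine le_trans (measure_mono fun ω hω => ?_) (this.trans (ENNReal.ofReal_le_ofReal ?_))
  · simpa [Real.dist_eq] using hω
  · have : (m n : ℝ)⁻¹ * (C / ε ^ 2) = (m n : ℝ)⁻¹ * C / ε ^ 2 := by ring
    rw [this]
    have e : a n ^ 2 * ((m n : ℝ)⁻¹ * ∫ x, φ n x ^ 2 ∂Q) =
      (m n : ℝ)⁻¹ * (a n ^ 2 * ∫ x, φ n x ^ 2 ∂Q) := by ring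
    rw [e]
    gcongr

/-- `m^{1/2}` times a centered mean is bounded in probability. -/
lemma IsIIDArray.bddP_centered_mean [IsProbabilityMeasure Q] (h : IsIIDArray μ m Z Q)
    (hm : Tendsto m atTop atTop) {g : E → ℝ} (hg : MemLp g 2 Q) {a : ℕ → ℝ} {C : ℝ}
    (ha : ∀ᶠ n in atTop, a n ^ 2 * (m n : ℝ)⁻¹ ≤ C) :
    BddP μ (fun z : Σ n, Ω n => a z.1 *
      ((m z.1 : ℝ)⁻¹ * ∑ i, g (Z z.1 i z.2) - ∫ x, g x ∂Q)) := by
  intro ε hε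
  -- Chebyshev at level M gives D/M², so M² = (D+1)/ε is enough; the added 1 keeps M positive when
  -- `g` vanishes almost everywhere.
  set D := |C| * ∫ x, g x ^ 2 ∂Q with hD
  have hD0 : 0 ≤ D := mul_nonneg (abs_nonneg _) (integral_nonneg fun x => sq_nonneg _)
  have hM : 0 < Real.sqrt ((D + 1) / ε) := Real.sqrt_pos.2 (by positivity)
  refine ⟨Real.sqrt ((D + 1) / ε), ?_⟩
  filter_upwards [ha, hm.eventually_gt_atTop 0] with n h1 h3
  have := h.chebyshev hg h3 (a := a n) hM
  refine le_trans (measure_mono fun ω hω => ?_) (this.trans (ENNReal.ofReal_le_ofReal ?_))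
  · rw [Set.mem_ofPred_eq, Real.norm_eq_abs] at hω
    exact hω.le
  · rw [Real.sq_sqrt (by positivity), div_le_iff₀ (by positivity), ← mul_assoc,
      mul_div_cancel₀ _ hε.ne']
    calc a n ^ 2 * (m n : ℝ)⁻¹ * ∫ x, g x ^ 2 ∂Q ≤ |C| * ∫ x, g x ^ 2 ∂Q := by
          refine mul_le_mul_of_nonneg_right (h1.trans (le_abs_self _))
            (integral_nonneg fun x => sq_nonneg _)
      _ ≤ D + 1 := by linarith

/-- As for the law of large numbers, only the laws of the sums matter: the classical central limit
theorem for one sequence is read along `m`. -/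
lemma IsIIDArray.tendsto_charFun_real {ν : Measure ℝ} [IsProbabilityMeasure ν]
    {ξ : ∀ n, Fin (m n) → Ω n → ℝ}
    (h : IsIIDArray μ m ξ ν) (hL : MemLp id 2 ν) (h0 : ∫ x, x ∂ν = 0)
    (hm : Tendsto m atTop atTop) (t : ℝ) :
    Tendsto (fun n => charFun ((μ n).map fun ω => (Real.sqrt (m n))⁻¹ * ∑ i, ξ n i ω) t) atTop
      (𝓝 (Complex.exp (-(Var[id; ν] * t ^ 2 / 2 : ℝ)))) := by
  obtain ⟨Ω', _, P', ζ, -, hζ, hζi, hP'⟩ := exists_iid ℕ ν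
  have hid : ∀ i, IdentDistrib (ζ i) (ζ 0) P' P' := fun i =>
    ⟨(hζ i).aemeasurable, (hζ 0).aemeasurable, by rw [(hζ i).map_eq, (hζ 0).map_eq]⟩
  have hL0 : MemLp (ζ 0) 2 P' := by
    have : MemLp id 2 (P'.map (ζ 0)) := by rwa [(hζ 0).map_eq]
    exact this.comp_of_map (hζ 0).aemeasurable
  have hclt := (tendstoInDistribution_inv_sqrt_mul_sum_sub
    (P' := gaussianReal 0 Var[ζ 0; P'].toNNReal) HasLaw.id hL0 hζi hid).tendsto
  have hc := (ProbabilityMeasure.tendsto_iff_tendsto_charFun.1 hclt t).comp hm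
  simp only [Function.comp_def, ProbabilityMeasure.coe_mk, Measure.map_id, charFun_gaussianReal,
    (hζ 0).variance_eq, (hζ 0).integral_eq, h0, mul_zero, sub_zero] at hc
  have hmeas : ∀ n : ℕ, AEMeasurable (fun ω => (∑ i ∈ Finset.range n, ζ i ω)) P' :=
    fun n => Finset.aemeasurable_fun_sum _ fun i _ => (hζ i).aemeasurable
  convert hc using 2 with n
  · congr 1
    have hm' : Measurable fun x : ℝ => (Real.sqrt (m n))⁻¹ * x := by fun_prop
    have e1 := AEMeasurable.map_map_of_aemeasurable hm'.aemeasurable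
      (Finset.aemeasurable_fun_sum Finset.univ fun i _ => (h.law n i).aemeasurable)
    have e2 := AEMeasurable.map_map_of_aemeasurable hm'.aemeasurable (hmeas (m n))
    rw [map_sum_eq_of_iid (h.law n) (h.indep n) hζ hζi] at e1
    exact e1.symm.trans e2
  · rw [Real.coe_toNNReal _ (variance_nonneg _ _)]
    congr 1
    push_cast
    ring

/-- The central limit theorem for arrays, in terms of characteristic functions. -/
lemma IsIIDArray.tendsto_charFun [IsProbabilityMeasure Q] (h : IsIIDArray μ m Z Q) {g : E → ℝ}
    (hg : MemLp g 2 Q) (h0 : ∫ x, g x ∂Q = 0) (hm : Tendsto m atTop atTop) (t : ℝ) :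
    Tendsto (fun n => charFun ((μ n).map fun ω => (Real.sqrt (m n))⁻¹ * ∑ i, g (Z n i ω)) t) atTop
      (𝓝 (Complex.exp (-(Var[g; Q] * t ^ 2 / 2 : ℝ)))) := by
  have hga := hg.aestronglyMeasurable.aemeasurable
  have : IsProbabilityMeasure (Q.map g) := Measure.isProbabilityMeasure_map hga
  have h1 := (h.comp hga).tendsto_charFun_real
    ((memLp_map_measure_iff aestronglyMeasurable_id hga).2 hg)
    ((integral_map hga aestronglyMeasurable_id).trans h0) hm t
  rwa [variance_map aemeasurable_id hga, Function.id_comp] at h1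

end Arrays

/-! ### Plugging an estimated parameter into sample means and covariances. -/

section Equicontinuity

variable {E : Type*} [MeasurableSpace E] {Q : Measure E}

omit [MeasurableSpace E] in
lemma abs_mean_le {k : ℕ} (ζ : Fin k → E) {u G : E → ℝ} {c : ℝ}
    (hu : ∀ e, |u e| ≤ |G e| * c) :
    |(k : ℝ)⁻¹ * ∑ i, u (ζ i)| ≤ ((k : ℝ)⁻¹ * ∑ i, |G (ζ i)|) * c := by
  rw [abs_mul, abs_of_nonneg (by positivity : (0 : ℝ) ≤ (k : ℝ)⁻¹), mul_assoc, Finset.sum_mul]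
  gcongr
  exact (Finset.abs_sum_le_sum_abs _ _).trans (Finset.sum_le_sum fun i _ => hu _)

/-- With `u` an increment between two parameters at distance c, this bounds the oscillation of the
empirical process between an estimate and the nearest point of a net. -/
lemma abs_mean_sub_integral_le {k : ℕ} (ζ : Fin k → E) {u G : E → ℝ} {c : ℝ}
    (hu : ∀ e, |u e| ≤ |G e| * c) (hG : Integrable G Q) :
    |(k : ℝ)⁻¹ * ∑ i, u (ζ i) - ∫ e, u e ∂Q| ≤
      ((k : ℝ)⁻¹ * ∑ i, |G (ζ i)| + ∫ e, |G e| ∂Q) * c := by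
  have h1 := abs_mean_le ζ hu
  have h2 : |∫ e, u e ∂Q| ≤ (∫ e, |G e| ∂Q) * c := by
    rw [← integral_mul_const]
    exact norm_integral_le_of_norm_le (f := u) (hG.abs.mul_const c)
      (.of_forall fun e => hu e)
  rw [add_mul]
  exact (abs_sub _ _).trans (add_le_add h1 h2)

variable {Ω : ℕ → Type*} [∀ n, MeasurableSpace (Ω n)] {μ : ∀ n, Measure (Ω n)}
  [∀ n, IsProbabilityMeasure (μ n)] [IsProbabilityMeasure Q]
  {m : ℕ → ℕ} {Z : ∀ n, Fin (m n) → Ω n → E} {d : ℕ} {V : Set (Vec d)} {θs : Vec d}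
  {θhat : ∀ n, Ω n → Vec d}

lemma tendsto_inv_sqrt_natCast : Tendsto (fun n : ℕ => (Real.sqrt (n : ℝ))⁻¹) atTop (𝓝 0) :=
  tendsto_inv_atTop_zero.comp (Real.tendsto_sqrt_atTop.comp tendsto_natCast_atTop_atTop)

/-- Stochastic equicontinuity at the root-`n` scale for a Lipschitz family of functions. -/
lemma IsIIDArray.equicontinuity (h : IsIIDArray μ m Z Q) (hm : Tendsto m atTop atTop)
    {g : E → Vec d → ℝ} (hg : ∀ θ, Measurable fun e => g e θ) {G : E → ℝ} (hG : MemLp G 2 Q)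
    (hV : V ∈ 𝓝 θs)
    (hlip : ∀ e, ∀ θ₁ ∈ V, ∀ θ₂ ∈ V, |g e θ₁ - g e θ₂| ≤ G e * ‖θ₁ - θ₂‖)
    (hθ : RootNConsistent μ θhat θs) :
    Tendsto (fun z : Σ n, Ω n => Real.sqrt z.1 *
      ((m z.1 : ℝ)⁻¹ * ∑ i, (g (Z z.1 i z.2) (θhat z.1 z.2) - g (Z z.1 i z.2) θs) -
        ∫ e, (g e (θhat z.1 z.2) - g e θs) ∂Q)) (whp μ) (𝓝 0) := by
  have hlip' : ∀ e, ∀ θ₁ ∈ V, ∀ θ₂ ∈ V, |g e θ₁ - g e θ₂| ≤ |G e| * ‖θ₁ - θ₂‖ :=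
    fun e θ₁ h1 θ₂ h2 => (hlip e θ₁ h1 θ₂ h2).trans (by gcongr; exact le_abs_self _)
  have hG1 : Integrable G Q := hG.integrable (by norm_num)
  have hθsV : θs ∈ V := mem_of_mem_nhds hV
  have hint : ∀ θ ∈ V, Integrable (fun e => g e θ - g e θs) Q := fun θ hθV =>
    (hG1.abs.mul_const ‖θ - θs‖).mono' ((hg θ).sub (hg θs)).aestronglyMeasurable
      (.of_forall fun e => hlip' e θ hθV θs hθsV)
  have hloc : ∀ x : Vec d, ∀ᶠ n : ℕ in atTop, θs + (Real.sqrt (n : ℝ))⁻¹ • x ∈ V := by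
    intro x
    have : Tendsto (fun n : ℕ => θs + (Real.sqrt (n : ℝ))⁻¹ • x) atTop (𝓝 (θs + (0 : ℝ) • x)) :=
      (tendsto_inv_sqrt_natCast.smul_const x).const_add θs
    rw [zero_smul, add_zero] at this
    exact this hV
  -- At a fixed local parameter x the increment has second moment at most ‖x‖² E G² / n, which
  -- cancels the factor n from the scaling. Chebyshev then leaves a multiple of 1/`m n`, so only `m
  -- → ∞` is needed and no relation between m and n.
  have hpt : ∀ x : Vec d, Tendsto (fun z : Σ n, Ω n => Real.sqrt z.1 *
      ((m z.1 : ℝ)⁻¹ * ∑ i, (g (Z z.1 i z.2) (θs + (Real.sqrt z.1)⁻¹ • x) - g (Z z.1 i z.2) θs) -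
        ∫ e, (g e (θs + (Real.sqrt z.1)⁻¹ • x) - g e θs) ∂Q)) (whp μ) (𝓝 0) := by
    intro x
    have hb : ∀ᶠ n : ℕ in atTop, ∀ e, |g e (θs + (Real.sqrt (n : ℝ))⁻¹ • x) - g e θs| ≤
        |G e| * ((Real.sqrt (n : ℝ))⁻¹ * ‖x‖) := by
      filter_upwards [hloc x] with n hn e
      have := hlip' e _ hn θs hθsV
      rwa [add_sub_cancel_left, norm_smul, Real.norm_of_nonneg (by positivity)] at this
    refine h.tendsto_centered_mean hm
      (φ := fun n e => g e (θs + (Real.sqrt (n : ℝ))⁻¹ • x) - g e θs)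
      (a := fun n => Real.sqrt n) (C := ‖x‖ ^ 2 * ∫ e, G e ^ 2 ∂Q) ?_ ?_
    · filter_upwards [hb] with n hn
      refine (hG.abs.mul_const ((Real.sqrt (n : ℝ))⁻¹ * ‖x‖)).mono
        ((hg _).sub (hg θs)).aestronglyMeasurable (.of_forall fun e => ?_)
      exact (hn e).trans (le_abs_self _)
    · filter_upwards [hb, eventually_gt_atTop 0] with n hn h0
      have hn0 : (0 : ℝ) < n := by exact_mod_cast h0
      rw [← integral_const_mul, ← integral_const_mul]
      refine integral_mono_of_nonneg (.of_forall fun e => by positivity)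
        (hG.integrable_sq.const_mul _) (.of_forall fun e => ?_)
      have h1 := pow_le_pow_left₀ (abs_nonneg _) (hn e) 2
      rw [sq_abs, mul_pow, mul_pow, sq_abs, inv_pow, Real.sq_sqrt hn0.le] at h1
      beta_reduce
      rw [Real.sq_sqrt hn0.le]
      calc _ ≤ (n : ℝ) * (G e ^ 2 * ((n : ℝ)⁻¹ * ‖x‖ ^ 2)) := by gcongr
        _ = _ := by field_simp
  rw [Metric.tendsto_nhds]
  intro ε hε
  refine hθ.bddP.mem_whp fun M => ?_
  have hI0 : 0 ≤ ∫ e, |G e| ∂Q := integral_nonneg fun e => abs_nonneg _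
  -- Once the sample mean of |G| is below E|G| + 1, K bounds the Lipschitz constant of the centered
  -- mean. Net radius ε/(2K) in the rescaled parameter therefore costs at most ε/2.
  set K : ℝ := 2 * (∫ e, |G e| ∂Q) + 1 with hK
  have hK0 : 0 < K := by positivity
  -- A finite net of the ball containing √n(θ̂ - θ*) makes the pointwise convergence `hpt` uniform.
  obtain ⟨t, -, ht, hcov⟩ := (isCompact_closedBall (0 : Vec d) |M|).finite_cover_balls
    (show 0 < ε / (2 * K) by positivity)
  have hmean := (h.tendsto_mean hG1.abs hm).eventually_lt_const
    (show ∫ e, |G e| ∂Q < (∫ e, |G e| ∂Q) + 1 by linarith)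
  have hnet := (eventually_all_finite ht).2 fun x (_ : x ∈ t) =>
    Metric.tendsto_nhds.1 (hpt x) (ε / 2) (by positivity)
  have hnetV := (eventually_all_finite ht).2 fun x (_ : x ∈ t) =>
    (tendsto_fst_whp (μ := μ)).eventually (hloc x)
  filter_upwards [hmean, hnet, hnetV, hθ.tendsto hV, tendsto_fst_whp.eventually_gt_atTop 0]
    with z h1 h2 h3 h4 h5 hzM
  have hs : 0 < Real.sqrt (z.1 : ℝ) := Real.sqrt_pos.2 (by exact_mod_cast h5)
  obtain ⟨x, hx, hdx⟩ := Set.mem_iUnion₂.1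
    (hcov (mem_closedBall_zero_iff.2 (hzM.trans (le_abs_self M))))
  have h2x := h2 x hx
  have h3x := h3 x hx
  rw [Real.dist_eq, sub_zero] at h2x
  rw [Metric.mem_ball, dist_eq_norm] at hdx
  have hbd := abs_mean_sub_integral_le (Q := Q) (fun i => Z z.1 i z.2)
    (fun e => hlip' e (θhat z.1 z.2) h4 (θs + (Real.sqrt z.1)⁻¹ • x) h3x) hG1
  have hnorm : Real.sqrt z.1 * ‖θhat z.1 z.2 - (θs + (Real.sqrt z.1)⁻¹ • x)‖ < ε / (2 * K) := by
    have e1 : Real.sqrt z.1 • (θhat z.1 z.2 - (θs + (Real.sqrt z.1)⁻¹ • x)) =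
        Real.sqrt z.1 • (θhat z.1 z.2 - θs) - x := by
      rw [← sub_sub, smul_sub, smul_smul, mul_inv_cancel₀ hs.ne', one_smul]
    rw [← Real.norm_of_nonneg hs.le, ← norm_smul, Real.norm_of_nonneg hs.le, e1]
    exact hdx
  have hdiff : |Real.sqrt z.1 * ((m z.1 : ℝ)⁻¹ * ∑ i, (g (Z z.1 i z.2) (θhat z.1 z.2) -
      g (Z z.1 i z.2) (θs + (Real.sqrt z.1)⁻¹ • x)) -
        ∫ e, (g e (θhat z.1 z.2) - g e (θs + (Real.sqrt z.1)⁻¹ • x)) ∂Q)| < ε / 2 := by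
    rw [abs_mul, abs_of_pos hs]
    calc _ ≤ Real.sqrt z.1 * (((m z.1 : ℝ)⁻¹ * ∑ i, |G (Z z.1 i z.2)| + ∫ e, |G e| ∂Q) *
          ‖θhat z.1 z.2 - (θs + (Real.sqrt z.1)⁻¹ • x)‖) := by gcongr
      _ = ((m z.1 : ℝ)⁻¹ * ∑ i, |G (Z z.1 i z.2)| + ∫ e, |G e| ∂Q) *
          (Real.sqrt z.1 * ‖θhat z.1 z.2 - (θs + (Real.sqrt z.1)⁻¹ • x)‖) := by ring
      _ ≤ K * (Real.sqrt z.1 * ‖θhat z.1 z.2 - (θs + (Real.sqrt z.1)⁻¹ • x)‖) := by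
          gcongr
          rw [hK]; linarith
      _ < K * (ε / (2 * K)) := by gcongr
      _ = ε / 2 := by field_simp
  rw [Real.dist_eq, sub_zero]
  refine lt_of_eq_of_lt ?_ ((abs_add_le _ _).trans_lt (add_lt_add hdiff h2x) |>.trans_eq
    (add_halves ε))
  congr 1
  rw [← mul_add]
  congr 1
  have eI : ∫ e, (g e (θhat z.1 z.2) - g e (θs + (Real.sqrt z.1)⁻¹ • x)) ∂Q =
      ∫ e, (g e (θhat z.1 z.2) - g e θs) ∂Q -
        ∫ e, (g e (θs + (Real.sqrt z.1)⁻¹ • x) - g e θs) ∂Q := by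
    rw [← integral_sub (hint _ h4) (hint _ h3x)]
    congr 1; ext e; ring
  rw [eI]
  simp only [Finset.sum_sub_distrib]
  ring

/-- Law of large numbers for a mean evaluated at a consistent estimator. -/
lemma IsIIDArray.tendsto_mean_of_lipschitz (h : IsIIDArray μ m Z Q) (hm : Tendsto m atTop atTop)
    {g : E → Vec d → ℝ} (hg : Integrable (fun e => g e θs) Q) {L : E → ℝ} (hL : Integrable L Q)
    (hV : V ∈ 𝓝 θs) (hlip : ∀ e, ∀ θ ∈ V, |g e θ - g e θs| ≤ |L e| * ‖θ - θs‖)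
    (hθ : Tendsto (fun z : Σ n, Ω n => θhat z.1 z.2) (whp μ) (𝓝 θs)) :
    Tendsto (fun z : Σ n, Ω n => (m z.1 : ℝ)⁻¹ * ∑ i, g (Z z.1 i z.2) (θhat z.1 z.2)) (whp μ)
      (𝓝 (∫ e, g e θs ∂Q)) := by
  have h1 := h.tendsto_mean hg hm
  have h2 : Tendsto (fun z : Σ n, Ω n => (m z.1 : ℝ)⁻¹ *
      ∑ i, (g (Z z.1 i z.2) (θhat z.1 z.2) - g (Z z.1 i z.2) θs)) (whp μ) (𝓝 0) := by
    have h3 := (h.tendsto_mean hL.abs hm).mul (tendsto_iff_norm_sub_tendsto_zero.1 hθ)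
    rw [mul_zero] at h3
    refine squeeze_zero_norm' ?_ h3
    filter_upwards [hθ hV] with z hz
    exact abs_mean_le (fun i => Z z.1 i z.2) (fun e => hlip e _ hz)
  have h3 := h1.add h2
  rw [add_zero] at h3
  refine h3.congr fun z => ?_
  rw [← mul_add, ← Finset.sum_add_distrib]
  simp

/-- Expressed through uncentered means, the sample covariance becomes accessible to the law of large
numbers. -/
lemma sampleCov_apply {n k l : ℕ} (u : Fin n → Vec k) (v : Fin n → Vec l) (a : Fin k)
    (b : Fin l) : sampleCov u v a b = (n : ℝ)⁻¹ * ∑ i, u i a * v i b -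
      ((n : ℝ)⁻¹ * ∑ i, u i a) * ((n : ℝ)⁻¹ * ∑ i, v i b) := by
  have hmean : ∀ {k : ℕ} (w : Fin n → Vec k) (a : Fin k),
      sampleMean w a = (n : ℝ)⁻¹ * ∑ i, w i a := by
    intro k w a
    simp [sampleMean]
  rw [sampleCov, Matrix.of_apply, hmean, hmean]
  rcases Nat.eq_zero_or_pos n with rfl | hn
  · simp
  have hn0 : (n : ℝ) ≠ 0 := by exact_mod_cast hn.ne'
  simp only [sub_mul, mul_sub, Finset.sum_sub_distrib, ← Finset.sum_mul, ← Finset.mul_sum,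
    Finset.sum_const, Finset.card_univ, Fintype.card_fin, nsmul_eq_mul]
  field_simp
  ring

omit [IsProbabilityMeasure Q] in
lemma memLp_coord {k : ℕ} {u : E → Vec k} (hu : MemLp u 2 Q) (a : Fin k) :
    MemLp (fun e => u e a) 2 Q :=
  hu.mono ((EuclideanSpace.proj a : Vec k →L[ℝ] ℝ).continuous.comp_aestronglyMeasurable hu.1)
    (.of_forall fun _ => PiLp.norm_apply_le _ _)

/-- Consistency of the sample cross-covariance matrix at a consistent estimator. -/
lemma IsIIDArray.tendsto_sampleCov (h : IsIIDArray μ m Z Q) (hm : Tendsto m atTop atTop)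
    {k l : ℕ} {u : E → Vec d → Vec k} {v : E → Vec d → Vec l}
    (hu : MemLp (fun e => u e θs) 2 Q) (hv : MemLp (fun e => v e θs) 2 Q)
    {G K : E → ℝ} (hG : MemLp G 2 Q) (hK : MemLp K 2 Q) (hV : V ∈ 𝓝 θs)
    (hulip : ∀ e, ∀ θ₁ ∈ V, ∀ θ₂ ∈ V, ‖u e θ₁ - u e θ₂‖ ≤ G e * ‖θ₁ - θ₂‖)
    (hvlip : ∀ e, ∀ θ₁ ∈ V, ∀ θ₂ ∈ V, ‖v e θ₁ - v e θ₂‖ ≤ K e * ‖θ₁ - θ₂‖)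
    (hθ : Tendsto (fun z : Σ n, Ω n => θhat z.1 z.2) (whp μ) (𝓝 θs)) :
    Tendsto (fun z : Σ n, Ω n => sampleCov (fun i => u (Z z.1 i z.2) (θhat z.1 z.2))
      (fun i => v (Z z.1 i z.2) (θhat z.1 z.2))) (whp μ)
      (𝓝 (covMat Q (fun e => u e θs) (fun e => v e θs))) := by
  have hθsV : θs ∈ V := mem_of_mem_nhds hV
  have hua := fun e θ (hθV : θ ∈ V) a => (PiLp.norm_apply_le (u e θ - u e θs) a).trans
    ((hulip e θ hθV θs hθsV).trans
      (mul_le_mul_of_nonneg_right (le_abs_self (G e)) (norm_nonneg _)))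
  have hvb := fun e θ (hθV : θ ∈ V) b => (PiLp.norm_apply_le (v e θ - v e θs) b).trans
    ((hvlip e θ hθV θs hθsV).trans
      (mul_le_mul_of_nonneg_right (le_abs_self (K e)) (norm_nonneg _)))
  simp only [PiLp.sub_apply, Real.norm_eq_abs] at hua hvb
  refine tendsto_pi_nhds.2 fun a => tendsto_pi_nhds.2 fun b => ?_
  simp only [sampleCov_apply]
  have hu2 := memLp_coord hu a
  have hv2 := memLp_coord hv b
  rw [covMat, Matrix.of_apply, covariance_eq_sub hu2 hv2]
  have huI := hu2.integrable (by norm_num)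
  have hvI := hv2.integrable (by norm_num)
  refine Tendsto.sub ?_ (Tendsto.mul ?_ ?_)
  -- The increment of a product contains a term quadratic in ‖θ - θs‖. Intersecting V with the unit
  -- ball makes it linear, and the envelope is integrable as a sum of products of square-integrable
  -- functions.
  · refine h.tendsto_mean_of_lipschitz hm (g := fun e θ => u e θ a * v e θ b)
      (L := fun e => |G e| * |v e θs b| + |u e θs a| * |K e| + |G e| * |K e|)
      (hu2.integrable_mul hv2) ?_ (Filter.inter_mem hV (Metric.ball_mem_nhds θs one_pos)) ?_ hθ
    · exact ((hG.abs.integrable_mul hv2.abs).add (hu2.abs.integrable_mul hK.abs)).add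
        (hG.abs.integrable_mul hK.abs)
    · intro e θ hθV
      have h1 := hua e θ hθV.1 a
      have h2 := hvb e θ hθV.1 b
      have h3 : ‖θ - θs‖ ≤ 1 := by
        have := hθV.2
        rw [Metric.mem_ball, dist_eq_norm] at this
        exact this.le
      rw [abs_of_nonneg (a := |G e| * _ + _ + _) (by positivity)]
      have e1 : u e θ a * v e θ b - u e θs a * v e θs b = (u e θ a - u e θs a) * v e θs b +
          u e θs a * (v e θ b - v e θs b) +
          (u e θ a - u e θs a) * (v e θ b - v e θs b) := by ring
      rw [e1]
      calc _ ≤ |u e θ a - u e θs a| * |v e θs b| + |u e θs a| * |v e θ b - v e θs b| +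
            |u e θ a - u e θs a| * |v e θ b - v e θs b| := by
            rw [← abs_mul, ← abs_mul, ← abs_mul]
            exact abs_add_three _ _ _
        _ ≤ (|G e| * ‖θ - θs‖) * |v e θs b| + |u e θs a| * (|K e| * ‖θ - θs‖) +
            (|G e| * ‖θ - θs‖) * (|K e| * 1) := by
            gcongr
            exact h2.trans (by gcongr)
        _ = _ := by ring
  · exact h.tendsto_mean_of_lipschitz hm (g := fun e θ => u e θ a) huI
      (hG.integrable (by norm_num)) hV (fun e θ hθV => hua e θ hθV a) hθ
  · exact h.tendsto_mean_of_lipschitz hm (g := fun e θ => v e θ b) hvI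
      (hK.integrable (by norm_num)) hV (fun e θ hθV => hvb e θ hθV b) hθ

end Equicontinuity

/-! ### Slutsky's lemma and convergence in distribution via characteristic functions. -/

section Limits

variable {Ω : ℕ → Type*} [∀ n, MeasurableSpace (Ω n)] {μ : ∀ n, Measure (Ω n)}
  [∀ n, IsProbabilityMeasure (μ n)]

lemma norm_exp_mul_I_sub_le (x y : ℝ) :
    ‖Complex.exp (x * Complex.I) - Complex.exp (y * Complex.I)‖ ≤ |x - y| := by
  have e : Complex.exp (x * Complex.I) - Complex.exp (y * Complex.I) =
      Complex.exp (y * Complex.I) * (Complex.exp (Complex.I * ((x - y : ℝ) : ℂ)) - 1) := by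
    rw [mul_sub, ← Complex.exp_add, mul_one]
    congr 2
    push_cast
    ring
  rw [e, norm_mul, Complex.norm_exp_ofReal_mul_I, one_mul]
  exact Real.norm_exp_I_mul_ofReal_sub_one_le

/-- Slutsky's lemma for characteristic functions. -/
lemma tendsto_integral_exp_of_whp {X Y : (Σ n, Ω n) → ℝ} {c : ℂ}
    (hX : ∀ n, AEMeasurable (fun ω => X ⟨n, ω⟩) (μ n))
    (hY : ∀ n, AEMeasurable (fun ω => Y ⟨n, ω⟩) (μ n))
    (hXY : Tendsto (fun z => X z - Y z) (whp μ) (𝓝 0))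
    (hc : Tendsto (fun n => ∫ ω, Complex.exp (Y ⟨n, ω⟩ * Complex.I) ∂(μ n)) atTop (𝓝 c)) :
    Tendsto (fun n => ∫ ω, Complex.exp (X ⟨n, ω⟩ * Complex.I) ∂(μ n)) atTop (𝓝 c) := by
  have hint : ∀ {W : (Σ n, Ω n) → ℝ}, (∀ n, AEMeasurable (fun ω => W ⟨n, ω⟩) (μ n)) → ∀ n,
      Integrable (fun ω => Complex.exp (W ⟨n, ω⟩ * Complex.I)) (μ n) := by
    intro W hW n
    refine Integrable.of_bound (C := 1) ?_ (.of_forall fun ω => ?_)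
    · exact (Complex.measurable_exp.comp_aemeasurable
        ((Complex.measurable_ofReal.comp_aemeasurable (hW n)).mul_const _)).aestronglyMeasurable
    · rw [Complex.norm_exp_ofReal_mul_I]
  suffices Tendsto (fun n => ∫ ω, Complex.exp (X ⟨n, ω⟩ * Complex.I) ∂(μ n) -
      ∫ ω, Complex.exp (Y ⟨n, ω⟩ * Complex.I) ∂(μ n)) atTop (𝓝 0) by
    simpa using this.add hc
  rw [Metric.tendsto_nhds]
  intro ε hε
  have hS := mem_whp_iff_real.1 (Metric.tendsto_nhds.1 hXY (ε / 4) (by positivity)) (ε / 8)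
    (by positivity)
  filter_upwards [hS] with n hn
  rw [dist_zero_right, ← integral_sub (hint hX n) (hint hY n)]
  -- The measurable hull has the same measure as the exceptional event and can be integrated over.
  -- The budget is ε/4 off A plus 2 · ε/8 on A.
  set A := toMeasurable (μ n) {ω | (⟨n, ω⟩ : Σ n, Ω n) ∉ {z | dist (X z - Y z) 0 < ε / 4}} with hA
  have hAm : MeasurableSet A := measurableSet_toMeasurable _ _
  have hAr : (μ n).real A ≤ ε / 8 := by
    rw [measureReal_def, hA, measure_toMeasurable]
    exact ENNReal.toReal_le_of_le_ofReal (by positivity) hn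
  have hbound : ∀ ω, ‖Complex.exp (X ⟨n, ω⟩ * Complex.I) - Complex.exp (Y ⟨n, ω⟩ * Complex.I)‖ ≤
      ε / 4 + A.indicator (fun _ => (2 : ℝ)) ω := by
    intro ω
    by_cases hω : ω ∈ A
    · rw [Set.indicator_of_mem hω]
      refine (norm_sub_le _ _).trans ?_
      rw [Complex.norm_exp_ofReal_mul_I, Complex.norm_exp_ofReal_mul_I]
      linarith
    · rw [Set.indicator_of_notMem hω, add_zero]
      have : dist (X ⟨n, ω⟩ - Y ⟨n, ω⟩) 0 < ε / 4 := by
        by_contra hcon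
        exact hω (subset_toMeasurable _ _ hcon)
      rw [Real.dist_eq, sub_zero] at this
      exact (norm_exp_mul_I_sub_le _ _).trans this.le
  have hi : Integrable (A.indicator fun _ => (2 : ℝ)) (μ n) := (integrable_const _).indicator hAm
  refine (norm_integral_le_of_norm_le ((integrable_const (ε / 4)).add hi)
    (.of_forall hbound)).trans_lt ?_
  rw [integral_add' (integrable_const _) hi, integral_indicator_const _ hAm]
  simp only [integral_const, probReal_univ, smul_eq_mul, one_mul]
  linarith

/-- Asymptotic normality from convergence of characteristic functions. -/
lemma asympNormal_of_tendsto_integral_exp {d : ℕ} {θhat : ∀ n, Ω n → Vec d} {θ : Vec d}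
    {V : Matrix (Fin d) (Fin d) ℝ} (hV : V.PosSemidef)
    (hmeas : ∀ n, AEMeasurable (θhat n) (μ n))
    (hlim : ∀ t : Vec d, Tendsto (fun n : ℕ => ∫ ω, Complex.exp
      ((inner ℝ (Real.sqrt (n : ℝ) • (θhat n ω - θ)) t : ℝ) * Complex.I) ∂(μ n)) atTop
      (𝓝 (Complex.exp (-((t.ofLp ⬝ᵥ V.mulVec t.ofLp) / 2 : ℝ))))) :
    AsympNormal μ θhat θ V := by
  have hm : ∀ n : ℕ, AEMeasurable (fun ω => Real.sqrt (n : ℝ) • (θhat n ω - θ)) (μ n) :=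
    fun n => ((hmeas n).sub_const θ).const_smul (Real.sqrt (n : ℝ))
  refine ⟨hV, hm, aemeasurable_id, ?_⟩
  -- Lévy's continuity theorem in ℝᵈ: treating each t separately plays the role of the Cramér–Wold
  -- device.
  refine ProbabilityMeasure.tendsto_iff_tendsto_charFun.2 fun t => ?_
  simp only [ProbabilityMeasure.coe_mk, Measure.map_id, charFun_multivariateGaussian hV]
  convert hlim t using 2 with n
  · rw [charFun_apply, integral_map (hm n)]
    exact (Continuous.aestronglyMeasurable (by fun_prop))
  · congr 1
    simp

/-- The central limit theorem for two independent samples, in terms of characteristic functions. -/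
lemma tendsto_integral_exp_two_sample {E E' : Type*} [MeasurableSpace E] [MeasurableSpace E']
    {Q : Measure E} {Q' : Measure E'} [IsProbabilityMeasure Q] [IsProbabilityMeasure Q']
    {m m' : ℕ → ℕ} {Z : ∀ n, Fin (m n) → Ω n → E} {Z' : ∀ n, Fin (m' n) → Ω n → E'}
    (h : IsIIDArray μ m Z Q) (h' : IsIIDArray μ m' Z' Q')
    (hind : ∀ n, IndepFun (fun ω i => Z n i ω) (fun ω j => Z' n j ω) (μ n))
    (hm : Tendsto m atTop atTop) (hm' : Tendsto m' atTop atTop)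
    {a : E → ℝ} {b : E' → ℝ} (ham : Measurable a) (hbm : Measurable b)
    (ha : MemLp a 2 Q) (hb : MemLp b 2 Q') (ha0 : ∫ e, a e ∂Q = 0) (hb0 : ∫ e, b e ∂Q' = 0)
    (c : ℝ) :
    Tendsto (fun n => ∫ ω, Complex.exp (((Real.sqrt (m n))⁻¹ * ∑ i, a (Z n i ω) +
        c * ((Real.sqrt (m' n))⁻¹ * ∑ j, b (Z' n j ω)) : ℝ) * Complex.I) ∂(μ n)) atTop
      (𝓝 (Complex.exp (-((Var[a; Q] + c ^ 2 * Var[b; Q']) / 2 : ℝ)))) := by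
  have h1 := h.tendsto_charFun ha ha0 hm 1
  have h2 := h'.tendsto_charFun hb hb0 hm' c
  have h12 := h1.mul h2
  rw [← Complex.exp_add] at h12
  convert h12 using 2 with n
  · have mX : AEMeasurable (fun ω => (Real.sqrt (m n))⁻¹ * ∑ i, a (Z n i ω)) (μ n) :=
      (Finset.aemeasurable_fun_sum _ fun i _ =>
        ham.comp_aemeasurable (h.law n i).aemeasurable).const_mul _
    have mY : AEMeasurable (fun ω => (Real.sqrt (m' n))⁻¹ * ∑ j, b (Z' n j ω)) (μ n) :=
      (Finset.aemeasurable_fun_sum _ fun i _ =>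
        hbm.comp_aemeasurable (h'.law n i).aemeasurable).const_mul _
    have hi := (hind n).comp
      (φ := fun v : Fin (m n) → E => (Real.sqrt (m n))⁻¹ * ∑ i, a (v i))
      (ψ := fun v : Fin (m' n) → E' => c * ((Real.sqrt (m' n))⁻¹ * ∑ j, b (v j)))
      (by fun_prop) (by fun_prop)
    have key := congrFun (hi.charFun_map_fun_add_eq_mul mX (mY.const_mul c)) 1
    rw [Pi.mul_apply] at key
    have e2 := charFun_map_mul_comp mY c 1
    rw [e2, mul_one] at key
    have mXY : AEMeasurable (fun ω => (Real.sqrt (m n))⁻¹ * ∑ i, a (Z n i ω) +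
        c * ((Real.sqrt (m' n))⁻¹ * ∑ j, b (Z' n j ω))) (μ n) := mX.add (mY.const_mul c)
    rw [← key, charFun_apply_real, integral_map mXY
      (Continuous.aestronglyMeasurable (by fun_prop))]
    simp
  · congr 1
    push_cast
    ring

end Limits

/-! ### Linear combinations, covariance matrices and the sandwich form. -/

section Algebra

variable {E : Type*} [MeasurableSpace E] {Q : Measure E} [IsProbabilityMeasure Q] {k l : ℕ}

/-- The linear combination of the coordinates of a random vector with given coefficients. -/
def linComb (τ : Fin k → ℝ) (g : E → Vec k) : E → ℝ := fun e => ∑ i, τ i * g e i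

omit [IsProbabilityMeasure Q] in
lemma memLp_linComb (τ : Fin k → ℝ) {g : E → Vec k} (hg : MemLp g 2 Q) :
    MemLp (linComb τ g) 2 Q :=
  memLp_finsetSum _ fun i _ => (memLp_coord hg i).const_mul (τ i)

lemma measurable_linComb (τ : Fin k → ℝ) {g : E → Vec k} (hg : Measurable g) :
    Measurable (linComb τ g) := by
  unfold linComb
  fun_prop

lemma integral_linComb (τ : Fin k → ℝ) {g : E → Vec k} (hg : MemLp g 2 Q)
    (h0 : ∫ e, g e ∂Q = 0) : ∫ e, linComb τ g e ∂Q = 0 := by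
  unfold linComb
  rw [integral_finsetSum _ fun i _ => ((memLp_coord hg i).integrable (by norm_num)).const_mul _]
  refine Finset.sum_eq_zero fun i _ => ?_
  rw [integral_const_mul]
  have := (EuclideanSpace.proj i : Vec k →L[ℝ] ℝ).integral_comp_comm
    (hg.integrable (by norm_num))
  rw [h0, map_zero] at this
  change ∫ e, g e i ∂Q = 0 at this
  rw [this, mul_zero]

lemma covariance_linComb (τ : Fin k → ℝ) (σ : Fin l → ℝ) {g : E → Vec k} {h : E → Vec l}
    (hg : MemLp g 2 Q) (hh : MemLp h 2 Q) :
    cov[linComb τ g, linComb σ h; Q] = τ ⬝ᵥ (covMat Q g h).mulVec σ := by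
  unfold linComb
  rw [covariance_fun_sum_fun_sum (fun i => (memLp_coord hg i).const_mul _)
    (fun i => (memLp_coord hh i).const_mul _)]
  simp only [covariance_const_mul_left, covariance_const_mul_right, dotProduct, Matrix.mulVec,
    covMat, Matrix.of_apply, Finset.mul_sum]
  refine Finset.sum_congr rfl fun i _ => Finset.sum_congr rfl fun j _ => ?_
  ring

omit [IsProbabilityMeasure Q] in
lemma covMat_transpose (g : E → Vec k) (h : E → Vec l) :
    (covMat Q g h).transpose = covMat Q h g := by
  ext i j
  simp [covMat, covariance_comm]

lemma covMat_posSemidef {g : E → Vec k} (hg : MemLp g 2 Q) : (covMat Q g g).PosSemidef := by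
  refine Matrix.PosSemidef.of_dotProduct_mulVec_nonneg (covMat_transpose g g) fun x => ?_
  rw [star_trivial, ← covariance_linComb x x hg hg,
    covariance_self (memLp_linComb x hg).aemeasurable]
  exact variance_nonneg _ _

lemma sandwich_posSemidef {d : ℕ} (H : Matrix (Fin d) (Fin d) ℝ) {G : Matrix (Fin d) (Fin d) ℝ}
    (hG : G.PosSemidef) : (sandwich H G).PosSemidef := by
  have := hG.mul_mul_conjTranspose_same H⁻¹
  rwa [Matrix.conjTranspose_eq_transpose_of_trivial, Matrix.transpose_nonsing_inv] at this

lemma sandwich_sub {d : ℕ} (H G G' : Matrix (Fin d) (Fin d) ℝ) :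
    sandwich H G - sandwich H G' = sandwich H (G - G') := by
  simp [sandwich, mul_sub, sub_mul]

/-- The sign is irrelevant to the quadratic form; it is kept so that -H⁻ᵀt is exactly the
coefficient vector occurring in the linearization. -/
lemma dotProduct_sandwich {d : ℕ} (H G : Matrix (Fin d) (Fin d) ℝ) (t : Fin d → ℝ) :
    t ⬝ᵥ (sandwich H G).mulVec t =
      (-(H⁻¹.transpose.mulVec t)) ⬝ᵥ G.mulVec (-(H⁻¹.transpose.mulVec t)) := by
  rw [sandwich, ← Matrix.transpose_nonsing_inv, Matrix.mulVec_neg, dotProduct_neg, neg_dotProduct,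
    neg_neg, ← Matrix.mulVec_mulVec, ← Matrix.mulVec_mulVec, Matrix.dotProduct_mulVec,
    ← Matrix.mulVec_transpose]

end Algebra

/-! ### Matrix–vector identities, continuity and measurability. -/

section MatrixVector

variable {k l r : ℕ}

lemma mulVec_apply (A : Matrix (Fin k) (Fin l) ℝ) (v : Vec l) (a : Fin k) :
    mulVec A v a = ∑ b, A a b * v b := rfl

lemma mulVec_add (A : Matrix (Fin k) (Fin l) ℝ) (v w : Vec l) :
    mulVec A (v + w) = mulVec A v + mulVec A w := by
  ext a; simp [mulVec_apply, mul_add, Finset.sum_add_distrib]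

lemma mulVec_sub (A : Matrix (Fin k) (Fin l) ℝ) (v w : Vec l) :
    mulVec A (v - w) = mulVec A v - mulVec A w := by
  ext a; simp [mulVec_apply, mul_sub, Finset.sum_sub_distrib]

lemma mulVec_smul (A : Matrix (Fin k) (Fin l) ℝ) (c : ℝ) (v : Vec l) :
    mulVec A (c • v) = c • mulVec A v := by
  ext a
  simp only [mulVec_apply, PiLp.smul_apply, smul_eq_mul, Finset.mul_sum]
  exact Finset.sum_congr rfl fun b _ => by ring

lemma sub_mulVec (A A' : Matrix (Fin k) (Fin l) ℝ) (v : Vec l) :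
    mulVec (A - A') v = mulVec A v - mulVec A' v := by
  ext a; simp [mulVec_apply, sub_mul, Finset.sum_sub_distrib]

lemma smul_mulVec (c : ℝ) (A : Matrix (Fin k) (Fin l) ℝ) (v : Vec l) :
    mulVec (c • A) v = c • mulVec A v := by
  ext a; simp [mulVec_apply, mul_assoc, Finset.mul_sum]

lemma one_mulVec (v : Vec l) : mulVec (1 : Matrix (Fin l) (Fin l) ℝ) v = v := by
  ext a; simp [mulVec]

lemma mulVec_mulVec (A : Matrix (Fin k) (Fin l) ℝ) (A' : Matrix (Fin l) (Fin r) ℝ) (v : Vec r) :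
    mulVec A (mulVec A' v) = mulVec (A * A') v := by
  simp [mulVec, Matrix.mulVec_mulVec]

lemma toEuclideanCLM_eq_mulVec (A : Matrix (Fin k) (Fin k) ℝ) (v : Vec k) :
    Matrix.toEuclideanCLM (n := Fin k) (𝕜 := ℝ) A v = mulVec A v := rfl

lemma inner_mulVec (A : Matrix (Fin k) (Fin l) ℝ) (v : Vec l) (t : Vec k) :
    (inner ℝ (mulVec A v) t : ℝ) = ∑ b, (A.transpose.mulVec t.ofLp) b * v b := by
  simp only [PiLp.inner_apply, mulVec_apply, Matrix.mulVec, dotProduct, Matrix.transpose_apply,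
    RCLike.inner_apply, conj_trivial, Finset.mul_sum, Finset.sum_mul]
  rw [Finset.sum_comm]
  exact Finset.sum_congr rfl fun b _ => Finset.sum_congr rfl fun a _ => by ring

lemma sampleMean_apply {n : ℕ} (w : Fin n → Vec k) (a : Fin k) :
    sampleMean w a = (n : ℝ)⁻¹ * ∑ i, w i a := by
  simp [sampleMean]

lemma tendsto_vec {α : Type*} {F : Filter α} {W : α → Vec k} {c : Vec k}
    (h : ∀ a, Tendsto (fun z => W z a) F (𝓝 (c a))) : Tendsto W F (𝓝 c) :=
  ((PiLp.continuous_toLp 2 _).tendsto _).comp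
    (tendsto_pi_nhds.2 h : Tendsto (fun z => (W z).ofLp) F _)

lemma tendsto_mulVec {α : Type*} {F : Filter α} {A : α → Matrix (Fin k) (Fin l) ℝ}
    {A₀ : Matrix (Fin k) (Fin l) ℝ} (hA : Tendsto A F (𝓝 A₀)) {W : α → Vec l}
    (hW : Tendsto W F (𝓝 0)) : Tendsto (fun z => mulVec (A z) (W z)) F (𝓝 0) := by
  refine tendsto_vec fun a => ?_
  have : Tendsto (fun z => ∑ b, A z a b * W z b) F (𝓝 (∑ b, A₀ a b * (0 : Vec l) b)) :=
    tendsto_finsetSum _ fun b _ =>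
      (tendsto_pi_nhds.1 (tendsto_pi_nhds.1 hA a) b).mul
        (((EuclideanSpace.proj b : Vec l →L[ℝ] ℝ).continuous.tendsto 0).comp hW)
  simpa using! this

lemma abs_apply_le_norm_toEuclideanCLM (A : Matrix (Fin k) (Fin k) ℝ) (a b : Fin k) :
    |A a b| ≤ ‖Matrix.toEuclideanCLM (n := Fin k) (𝕜 := ℝ) A‖ := by
  have h1 := (Matrix.toEuclideanCLM (n := Fin k) (𝕜 := ℝ) A).le_opNorm
    (EuclideanSpace.single b (1 : ℝ))
  rw [PiLp.norm_single, norm_one, mul_one] at h1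
  refine le_trans ?_ h1
  refine le_trans (le_of_eq ?_) (PiLp.norm_apply_le _ a)
  rw [toEuclideanCLM_eq_mulVec, mulVec_apply]
  simp

/-- Matrix inversion is a total function, continuous at every invertible matrix, so invertibility of
the matrices `A z` never has to be tracked separately. -/
lemma tendsto_matrix_inv {α : Type*} {F : Filter α} {A : α → Matrix (Fin k) (Fin k) ℝ}
    {A₀ : Matrix (Fin k) (Fin k) ℝ} (hA : Tendsto A F (𝓝 A₀)) (h₀ : IsUnit A₀) :
    Tendsto (fun z => (A z)⁻¹) F (𝓝 A₀⁻¹) := by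
  have hd : IsUnit A₀.det := (Matrix.isUnit_iff_isUnit_det _).1 h₀
  have : ContinuousAt Ring.inverse A₀.det := by
    rw [Ring.inverse_eq_inv']
    exact continuousAt_inv₀ hd.ne_zero
  exact (continuousAt_matrix_inv A₀ this).tendsto.comp hA

section Measurability

variable {α : Type*} [MeasurableSpace α] {ρ : Measure α}

lemma aemeasurable_vec {W : α → Vec k} (h : ∀ a, AEMeasurable (fun z => W z a) ρ) :
    AEMeasurable W ρ :=
  (WithLp.measurable_toLp 2 _).comp_aemeasurable (aemeasurable_pi_iff.2 h :
    AEMeasurable (fun z => (W z).ofLp) ρ)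

lemma aemeasurable_coord {W : α → Vec k} (h : AEMeasurable W ρ) (a : Fin k) :
    AEMeasurable (fun z => W z a) ρ :=
  (EuclideanSpace.proj a : Vec k →L[ℝ] ℝ).continuous.measurable.comp_aemeasurable h

lemma aemeasurable_sampleMean {n : ℕ} {W : Fin n → α → Vec k} (h : ∀ i, AEMeasurable (W i) ρ) :
    AEMeasurable (fun z => sampleMean fun i => W i z) ρ :=
  (Finset.aemeasurable_fun_sum Finset.univ fun i _ => h i).const_smul ((n : ℝ)⁻¹)

lemma aemeasurable_sampleCov {n : ℕ} {W : Fin n → α → Vec k} {W' : Fin n → α → Vec l}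
    (h : ∀ i, AEMeasurable (W i) ρ) (h' : ∀ i, AEMeasurable (W' i) ρ) (a : Fin k) (b : Fin l) :
    AEMeasurable (fun z => sampleCov (fun i => W i z) (fun i => W' i z) a b) ρ := by
  simp only [sampleCov, Matrix.of_apply]
  refine (Finset.aemeasurable_fun_sum _ fun i _ => ?_).const_mul _
  exact ((aemeasurable_coord (h i) a).sub (aemeasurable_coord (aemeasurable_sampleMean h) a)).mul
    ((aemeasurable_coord (h' i) b).sub (aemeasurable_coord (aemeasurable_sampleMean h') b))

lemma aemeasurable_matrix_mul {A : α → Matrix (Fin k) (Fin l) ℝ} {A' : α → Matrix (Fin l) (Fin r) ℝ}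
    (h : ∀ a b, AEMeasurable (fun z => A z a b) ρ) (h' : ∀ a b, AEMeasurable (fun z => A' z a b) ρ)
    (a : Fin k) (b : Fin r) : AEMeasurable (fun z => (A z * A' z) a b) ρ := by
  simp only [Matrix.mul_apply]
  exact Finset.aemeasurable_fun_sum _ fun i _ => (h a i).mul (h' i b)

lemma aemeasurable_mulVec {A : α → Matrix (Fin k) (Fin l) ℝ} {W : α → Vec l}
    (h : ∀ a b, AEMeasurable (fun z => A z a b) ρ) (h' : AEMeasurable W ρ) :
    AEMeasurable (fun z => mulVec (A z) (W z)) ρ :=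
  aemeasurable_vec fun a => by
    simp only [mulVec_apply]
    exact Finset.aemeasurable_fun_sum _ fun i _ => (h a i).mul (aemeasurable_coord h' i)

lemma aemeasurable_matrix_det {A : α → Matrix (Fin k) (Fin k) ℝ}
    (h : ∀ a b, AEMeasurable (fun z => A z a b) ρ) : AEMeasurable (fun z => (A z).det) ρ := by
  simp only [Matrix.det_apply]
  exact Finset.aemeasurable_fun_sum _ fun σ _ =>
    (Finset.aemeasurable_fun_prod _ fun i _ => h _ _).const_smul _

/-- By the adjugate formula each entry is a determinant divided by a determinant. -/
lemma aemeasurable_matrix_inv {A : α → Matrix (Fin k) (Fin k) ℝ}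
    (h : ∀ a b, AEMeasurable (fun z => A z a b) ρ) (a b : Fin k) :
    AEMeasurable (fun z => (A z)⁻¹ a b) ρ := by
  simp only [Matrix.inv_def, Ring.inverse_eq_inv', Matrix.smul_apply, smul_eq_mul,
    Matrix.adjugate_apply]
  refine (aemeasurable_matrix_det h).inv.mul (aemeasurable_matrix_det fun i j => ?_)
  by_cases hi : i = b
  · subst hi
    simp only [Matrix.updateRow_self]
    exact aemeasurable_const
  · simp only [Matrix.updateRow_ne hi]
    exact h i j

end Measurability

end MatrixVector

/-! ### Consequences of N/(n+N) → η. -/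

section SampleSizes

variable {N : ℕ → ℕ} {η : ℝ}

/-- Once N/(n+N) exceeds η/2, clearing the denominator gives N ≥ (η/2) n. -/
lemma tendsto_sampleSize_atTop (hη : 0 < η)
    (hN : Tendsto (fun n : ℕ => (N n : ℝ) / ((n : ℝ) + (N n : ℝ))) atTop (𝓝 η)) :
    Tendsto N atTop atTop := by
  rw [← tendsto_natCast_atTop_iff (R := ℝ)]
  refine tendsto_atTop_mono' _ ?_ (tendsto_natCast_atTop_atTop.const_mul_atTop (half_pos hη))
  filter_upwards [hN.eventually_const_lt (half_lt_self hη), eventually_gt_atTop 0] with n h1 h0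
  have hn : (0 : ℝ) < n := by exact_mod_cast h0
  have hN0 : (0 : ℝ) ≤ N n := Nat.cast_nonneg _
  rw [lt_div_iff₀ (by positivity)] at h1
  nlinarith

lemma tendsto_sampleSize_ratio (hη : 0 < η)
    (hN : Tendsto (fun n : ℕ => (N n : ℝ) / ((n : ℝ) + (N n : ℝ))) atTop (𝓝 η)) :
    Tendsto (fun n : ℕ => (n : ℝ) * (N n : ℝ)⁻¹) atTop (𝓝 ((1 - η) / η)) := by
  have h1 : Tendsto (fun n : ℕ => ((N n : ℝ) / ((n : ℝ) + (N n : ℝ)))⁻¹ - 1) atTop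
      (𝓝 (η⁻¹ - 1)) := (hN.inv₀ hη.ne').sub_const 1
  have e : (1 - η) / η = η⁻¹ - 1 := by field_simp
  rw [e]
  refine h1.congr' ?_
  filter_upwards [(tendsto_sampleSize_atTop hη hN).eventually_gt_atTop 0] with n hn
  have : (0 : ℝ) < N n := by exact_mod_cast hn
  field_simp
  ring

end SampleSizes

/-! ### First-order expansions and stochastic bounds at the root-n scale. -/

section Expansions

variable {Ω : ℕ → Type*} [∀ n, MeasurableSpace (Ω n)] {μ : ∀ n, Measure (Ω n)}
  [∀ n, IsProbabilityMeasure (μ n)] {E : Type*} [MeasurableSpace E] {Q : Measure E}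
  [IsProbabilityMeasure Q] {d k : ℕ} {V : Set (Vec d)} {θs : Vec d} {θhat : ∀ n, Ω n → Vec d}

omit [∀ n, IsProbabilityMeasure (μ n)] in
-- The Taylor remainder is ‖θ̂ - θ*‖ times a ratio tending to zero; after scaling by √n this is
-- o_p(1) times an O_p(1) term.
lemma RootNConsistent.tendsto_linearization {M : Vec d → Vec k} {L : Vec d →L[ℝ] Vec k}
    (hM : HasFDerivAt M L θs) (hθ : RootNConsistent μ θhat θs) :
    Tendsto (fun z : Σ n, Ω n => Real.sqrt z.1 • (M (θhat z.1 z.2) - M θs) -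
      L (Real.sqrt z.1 • (θhat z.1 z.2 - θs))) (whp μ) (𝓝 0) := by
  have ho := hM.isLittleO.comp_tendsto hθ.tendsto
  have h1 := hθ.bddP.tendsto_mul ho.norm_norm.tendsto_div_nhds_zero
  refine squeeze_zero_norm (fun z => ?_) h1
  have e : Real.sqrt z.1 • (M (θhat z.1 z.2) - M θs) - L (Real.sqrt z.1 • (θhat z.1 z.2 - θs)) =
      Real.sqrt z.1 • (M (θhat z.1 z.2) - M θs - L (θhat z.1 z.2 - θs)) := by
    rw [map_smul, smul_sub _ (_ - _)]
  rw [e, norm_smul, norm_smul]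
  simp only [Function.comp_apply]
  by_cases h0 : θhat z.1 z.2 - θs = 0
  · have : θhat z.1 z.2 = θs := sub_eq_zero.1 h0
    simp [this]
  · have : ‖θhat z.1 z.2 - θs‖ ≠ 0 := norm_ne_zero_iff.2 h0
    apply le_of_eq
    field_simp

/-- First-order expansion of the empirical estimating equation at a root-`n` consistent
estimator. -/
lemma IsIIDArray.tendsto_score_expansion {Z : ∀ n, Fin n → Ω n → E}
    (h : IsIIDArray μ (fun n => n) Z Q) {g : E → Vec d → Vec k}
    (hg : ∀ θ, Measurable fun e => g e θ) (hg2 : MemLp (fun e => g e θs) 2 Q)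
    {G : E → ℝ} (hG : MemLp G 2 Q) (hV : V ∈ 𝓝 θs)
    (hlip : ∀ e, ∀ θ₁ ∈ V, ∀ θ₂ ∈ V, ‖g e θ₁ - g e θ₂‖ ≤ G e * ‖θ₁ - θ₂‖)
    {L : Vec d →L[ℝ] Vec k} (hL : HasFDerivAt (fun θ => ∫ e, g e θ ∂Q) L θs)
    (hθ : RootNConsistent μ θhat θs) :
    Tendsto (fun z : Σ n, Ω n =>
      Real.sqrt z.1 • sampleMean (fun i => g (Z z.1 i z.2) (θhat z.1 z.2)) -
        Real.sqrt z.1 • sampleMean (fun i => g (Z z.1 i z.2) θs) -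
        L (Real.sqrt z.1 • (θhat z.1 z.2 - θs))) (whp μ) (𝓝 0) := by
  have hθsV : θs ∈ V := mem_of_mem_nhds hV
  have hint : ∀ θ ∈ V, Integrable (fun e => g e θ) Q := by
    intro θ hθV
    have h1 : Integrable (fun e => g e θ - g e θs) Q :=
      ((hG.integrable (by norm_num)).mul_const ‖θ - θs‖).mono'
        ((hg θ).sub (hg θs)).aestronglyMeasurable
        (.of_forall fun e => hlip e θ hθV θs hθsV)
    exact (h1.add (hg2.integrable (by norm_num))).congr (.of_forall fun e => by simp)
  refine tendsto_vec fun a => ?_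
  have h1 := h.equicontinuity tendsto_id (g := fun e θ => g e θ a) (G := G)
    (fun θ => (EuclideanSpace.proj a : Vec k →L[ℝ] ℝ).continuous.measurable.comp (hg θ)) hG hV
    (fun e θ₁ h1 θ₂ h2 => (PiLp.norm_apply_le (g e θ₁ - g e θ₂) a).trans (hlip e θ₁ h1 θ₂ h2)) hθ
  have h2 := ((EuclideanSpace.proj a : Vec k →L[ℝ] ℝ).continuous.tendsto 0).comp
    (hθ.tendsto_linearization hL)
  -- Equicontinuity removes the fluctuation of the increment around its mean, and differentiability
  -- of the mean replaces that mean by its linear part.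
  have h12 := h1.add h2
  rw [map_zero, add_zero] at h12
  refine h12.congr' ?_
  filter_upwards [hθ.tendsto hV] with z hz
  have eI : ∫ e, (g e (θhat z.1 z.2) a - g e θs a) ∂Q =
      (∫ e, g e (θhat z.1 z.2) ∂Q) a - (∫ e, g e θs ∂Q) a := by
    have := (EuclideanSpace.proj a : Vec k →L[ℝ] ℝ).integral_comp_comm ((hint _ hz).sub
      (hint _ hθsV))
    simp only [Pi.sub_apply] at this
    rw [integral_sub (hint _ hz) (hint _ hθsV)] at this
    exact this
  simp only [Function.comp_apply, EuclideanSpace.coe_proj, PiLp.sub_apply, PiLp.smul_apply,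
    smul_eq_mul, sampleMean_apply, eI, Finset.sum_sub_distrib]
  ring

/-- The difference of two sample means of the same family is asymptotically unaffected by the
estimation of the parameter. -/
lemma tendsto_sampleMean_sub_sampleMean {N : ℕ → ℕ} {Z : ∀ n, Fin n → Ω n → E}
    {Z' : ∀ n, Fin (N n) → Ω n → E}
    (h : IsIIDArray μ (fun n => n) Z Q) (h' : IsIIDArray μ N Z' Q) (hN : Tendsto N atTop atTop)
    {g : E → Vec d → Vec k} (hg : ∀ θ, Measurable fun e => g e θ)
    {G : E → ℝ} (hG : MemLp G 2 Q) (hV : V ∈ 𝓝 θs)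
    (hlip : ∀ e, ∀ θ₁ ∈ V, ∀ θ₂ ∈ V, ‖g e θ₁ - g e θ₂‖ ≤ G e * ‖θ₁ - θ₂‖)
    (hθ : RootNConsistent μ θhat θs) :
    Tendsto (fun z : Σ n, Ω n =>
      Real.sqrt z.1 • (sampleMean (fun i => g (Z z.1 i z.2) (θhat z.1 z.2)) -
        sampleMean (fun j => g (Z' z.1 j z.2) (θhat z.1 z.2))) -
      Real.sqrt z.1 • (sampleMean (fun i => g (Z z.1 i z.2) θs) -
        sampleMean (fun j => g (Z' z.1 j z.2) θs))) (whp μ) (𝓝 0) := by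
  refine tendsto_vec fun a => ?_
  have hga : ∀ θ, Measurable fun e => g e θ a := fun θ =>
    (EuclideanSpace.proj a : Vec k →L[ℝ] ℝ).continuous.measurable.comp (hg θ)
  have hla : ∀ e, ∀ θ₁ ∈ V, ∀ θ₂ ∈ V, |g e θ₁ a - g e θ₂ a| ≤ G e * ‖θ₁ - θ₂‖ :=
    fun e θ₁ h1 θ₂ h2 => (PiLp.norm_apply_le (g e θ₁ - g e θ₂) a).trans (hlip e θ₁ h1 θ₂ h2)
  have h1 := h.equicontinuity tendsto_id (g := fun e θ => g e θ a) (G := G) hga hG hV hla hθ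
  have h2 := h'.equicontinuity hN (g := fun e θ => g e θ a) (G := G) hga hG hV hla hθ
  -- Both increments are centered at the same integral, which cancels here.
  have h12 := h1.sub h2
  rw [sub_zero] at h12
  refine h12.congr fun z => ?_
  simp only [PiLp.sub_apply, PiLp.smul_apply, smul_eq_mul, sampleMean_apply,
    Finset.sum_sub_distrib]
  ring

lemma IsIIDArray.bddP_sampleMean {Z : ∀ n, Fin n → Ω n → E}
    (h : IsIIDArray μ (fun n => n) Z Q) {g : E → Vec k} (hg : MemLp g 2 Q)
    (h0 : ∫ e, g e ∂Q = 0) :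
    BddP μ (fun z : Σ n, Ω n => Real.sqrt z.1 • sampleMean (fun i => g (Z z.1 i z.2))) := by
  refine BddP.pi fun a => ?_
  have h1 := h.bddP_centered_mean tendsto_id (memLp_coord hg a) (a := fun n => Real.sqrt n)
    (C := 1) (by
      filter_upwards [eventually_gt_atTop 0] with n hn
      have : (0 : ℝ) < n := by exact_mod_cast hn
      rw [Real.sq_sqrt this.le, mul_inv_cancel₀ this.ne'])
  have e0 : ∫ e, g e a ∂Q = 0 := by
    have := (EuclideanSpace.proj a : Vec k →L[ℝ] ℝ).integral_comp_comm
      (hg.integrable (by norm_num))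
    rw [h0, map_zero] at this
    exact this
  simpa [sampleMean_apply, e0] using h1

lemma bddP_sampleMean_sub_sampleMean {N : ℕ → ℕ} {Z : ∀ n, Fin n → Ω n → E}
    {Z' : ∀ n, Fin (N n) → Ω n → E}
    (h : IsIIDArray μ (fun n => n) Z Q) (h' : IsIIDArray μ N Z' Q) (hN : Tendsto N atTop atTop)
    {c : ℝ} (hr : Tendsto (fun n : ℕ => (n : ℝ) * (N n : ℝ)⁻¹) atTop (𝓝 c))
    {g : E → Vec k} (hg : MemLp g 2 Q) :
    BddP μ (fun z : Σ n, Ω n => Real.sqrt z.1 • (sampleMean (fun i => g (Z z.1 i z.2)) -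
        sampleMean (fun j => g (Z' z.1 j z.2)))) := by
  refine BddP.pi fun a => ?_
  have h1 := h.bddP_centered_mean tendsto_id (memLp_coord hg a) (a := fun n => Real.sqrt n)
    (C := 1) (by
      filter_upwards [eventually_gt_atTop 0] with n hn
      have : (0 : ℝ) < n := by exact_mod_cast hn
      rw [Real.sq_sqrt this.le, mul_inv_cancel₀ this.ne'])
  -- The negative scale turns the sum of the two centered means into their difference, in which the
  -- expectations cancel. The bound `c + 1` comes from n/N → c.
  have h2 := h'.bddP_centered_mean hN (memLp_coord hg a) (a := fun n => -Real.sqrt n)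
    (C := c + 1) (by
      filter_upwards [hr.eventually_lt_const (lt_add_one c)] with n hn
      rw [neg_sq, Real.sq_sqrt (Nat.cast_nonneg n)]
      exact hn.le)
  refine (h1.add h2).mono' (C := 1) zero_le_one (.of_forall fun z => ?_)
  rw [one_mul]
  apply le_of_eq
  congr 1
  simp only [PiLp.sub_apply, PiLp.smul_apply, smul_eq_mul, sampleMean_apply]
  ring

end Expansions

/-! ### Regression identities behind the variance formula. -/

section Quadratic

variable {d q : ℕ}

lemma transpose_mul_inv {A : Matrix (Fin d) (Fin q) ℝ} {C : Matrix (Fin q) (Fin q) ℝ}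
    (hC : C.transpose = C) : (A * C⁻¹).transpose = C⁻¹ * A.transpose := by
  rw [Matrix.transpose_mul, Matrix.transpose_nonsing_inv, hC]

lemma dotProduct_mulVec_regression {A : Matrix (Fin d) (Fin q) ℝ} {C : Matrix (Fin q) (Fin q) ℝ}
    (hC : C.transpose = C) (τ : Fin d → ℝ) :
    τ ⬝ᵥ A.mulVec ((A * C⁻¹).transpose.mulVec τ) =
      τ ⬝ᵥ (A * C⁻¹ * A.transpose).mulVec τ := by
  rw [transpose_mul_inv hC, Matrix.mulVec_mulVec, Matrix.mul_assoc]

/-- The vector w = (AC⁻¹)ᵀτ solves the normal equations Cw = Aᵀτ. Hence the variance of the fitted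
part equals its covariance with the response, and both give the explained part. -/
lemma dotProduct_mulVec_regression_self {A : Matrix (Fin d) (Fin q) ℝ}
    {C : Matrix (Fin q) (Fin q) ℝ} (hC : C.transpose = C) (hCu : IsUnit C) (τ : Fin d → ℝ) :
    ((A * C⁻¹).transpose.mulVec τ) ⬝ᵥ C.mulVec ((A * C⁻¹).transpose.mulVec τ) =
      τ ⬝ᵥ (A * C⁻¹ * A.transpose).mulVec τ := by
  have hd : IsUnit C.det := (Matrix.isUnit_iff_isUnit_det _).1 hCu
  have e : C.mulVec ((A * C⁻¹).transpose.mulVec τ) = A.transpose.mulVec τ := by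
    rw [transpose_mul_inv hC, Matrix.mulVec_mulVec, ← Matrix.mul_assoc,
      Matrix.mul_nonsing_inv _ hd, Matrix.one_mul]
  rw [e, ← Matrix.mulVec_mulVec, Matrix.dotProduct_mulVec τ, ← Matrix.mulVec_transpose]

variable {E : Type*} [MeasurableSpace E] {Q : Measure E} [IsProbabilityMeasure Q]

lemma variance_linComb_sub {d q : ℕ} (τ : Fin d → ℝ) (w : Fin q → ℝ) {g : E → Vec d}
    {h : E → Vec q} (hg : MemLp g 2 Q) (hh : MemLp h 2 Q) (η c : ℝ) :
    Var[fun e => linComb τ g e - η * (linComb w h e - c); Q] =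
      τ ⬝ᵥ (covMat Q g g).mulVec τ - 2 * η * (τ ⬝ᵥ (covMat Q g h).mulVec w) +
        η ^ 2 * (w ⬝ᵥ (covMat Q h h).mulVec w) := by
  have h1 := memLp_linComb τ hg
  have h2 := memLp_linComb w hh
  have e : (fun e => linComb τ g e - η * (linComb w h e - c)) =
      fun e => (linComb τ g e - η * linComb w h e) + η * c := by
    ext e; ring
  have h3 : MemLp (fun e => η * linComb w h e) 2 Q := h2.const_mul η
  rw [e, variance_add_const (X := fun e => linComb τ g e - η * linComb w h e)
    (h1.sub h3).aestronglyMeasurable, variance_fun_sub h1 h3,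
    variance_const_mul, covariance_const_mul_right, covariance_linComb τ w hg hh,
    ← covariance_self h1.aemeasurable, ← covariance_self h2.aemeasurable,
    covariance_linComb τ τ hg hg, covariance_linComb w w hh hh]
  ring

lemma variance_const_mul_linComb_sub {q : ℕ} (w : Fin q → ℝ) {h : E → Vec q} (hh : MemLp h 2 Q)
    (η c : ℝ) : Var[fun e => η * (linComb w h e - c); Q] =
      η ^ 2 * (w ⬝ᵥ (covMat Q h h).mulVec w) := by
  have h2 := memLp_linComb w hh
  rw [variance_const_mul, variance_sub_const h2.aestronglyMeasurable,
    ← covariance_self h2.aemeasurable, covariance_linComb w w hh hh]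

end Quadratic

/-! ### From asymptotic linearity to normality; form and measurability of the estimator. -/

section Estimators

variable {Ω : ℕ → Type*} [∀ n, MeasurableSpace (Ω n)] {μ : ∀ n, Measure (Ω n)}
  [∀ n, IsProbabilityMeasure (μ n)] {d q : ℕ}

/-- Asymptotic normality of an estimator that is asymptotically linear in two independent
samples. -/
lemma asympNormal_of_linearization {E E' : Type*} [MeasurableSpace E] [MeasurableSpace E']
    {Q : Measure E} {Q' : Measure E'} [IsProbabilityMeasure Q] [IsProbabilityMeasure Q']
    {m m' : ℕ → ℕ} {Z : ∀ n, Fin (m n) → Ω n → E} {Z' : ∀ n, Fin (m' n) → Ω n → E'}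
    (h : IsIIDArray μ m Z Q) (h' : IsIIDArray μ m' Z' Q')
    (hind : ∀ n, IndepFun (fun ω i => Z n i ω) (fun ω j => Z' n j ω) (μ n))
    (hm : Tendsto m atTop atTop) (hm' : Tendsto m' atTop atTop)
    {θhat : ∀ n, Ω n → Vec d} {θ : Vec d} {V : Matrix (Fin d) (Fin d) ℝ} (hV : V.PosSemidef)
    (hmeas : ∀ n, AEMeasurable (θhat n) (μ n))
    (hlin : ∀ t : Vec d, ∃ (a : E → ℝ) (b : E' → ℝ) (c : ℝ), Measurable a ∧ Measurable b ∧
      MemLp a 2 Q ∧ MemLp b 2 Q' ∧ ∫ e, a e ∂Q = 0 ∧ ∫ e, b e ∂Q' = 0 ∧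
      t.ofLp ⬝ᵥ V.mulVec t.ofLp = Var[a; Q] + c ^ 2 * Var[b; Q'] ∧
      Tendsto (fun z : Σ n, Ω n => (inner ℝ (Real.sqrt z.1 • (θhat z.1 z.2 - θ)) t : ℝ) -
        ((Real.sqrt (m z.1))⁻¹ * ∑ i, a (Z z.1 i z.2) +
        c * ((Real.sqrt (m' z.1))⁻¹ * ∑ j, b (Z' z.1 j z.2)))) (whp μ) (𝓝 0)) :
    AsympNormal μ θhat θ V := by
  refine asympNormal_of_tendsto_integral_exp hV hmeas fun t => ?_
  obtain ⟨a, b, c, ham, hbm, ha, hb, ha0, hb0, hvar, hdiff⟩ := hlin t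
  rw [hvar]
  refine tendsto_integral_exp_of_whp
    (X := fun z => (inner ℝ (Real.sqrt z.1 • (θhat z.1 z.2 - θ)) t : ℝ))
    (Y := fun z => ((Real.sqrt (m z.1))⁻¹ * ∑ i, a (Z z.1 i z.2) +
        c * ((Real.sqrt (m' z.1))⁻¹ * ∑ j, b (Z' z.1 j z.2)))) ?_ ?_ hdiff
    (tendsto_integral_exp_two_sample h h' hind hm hm' ham hbm ha hb ha0 hb0 c)
  · intro n
    have : AEMeasurable (fun ω => Real.sqrt (n : ℝ) • (θhat n ω - θ)) (μ n) :=
      ((hmeas n).sub_const θ).const_smul (Real.sqrt (n : ℝ))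
    exact this.inner_const
  · intro n
    have mX : AEMeasurable (fun ω => (Real.sqrt (m n))⁻¹ * ∑ i, a (Z n i ω)) (μ n) :=
      (Finset.aemeasurable_fun_sum _ fun i _ =>
        ham.comp_aemeasurable (h.law n i).aemeasurable).const_mul _
    have mY : AEMeasurable (fun ω => (Real.sqrt (m' n))⁻¹ * ∑ j, b (Z' n j ω)) (μ n) :=
      (Finset.aemeasurable_fun_sum _ fun i _ =>
        hbm.comp_aemeasurable (h'.law n i).aemeasurable).const_mul _
    exact mX.add (mY.const_mul c)

variable {𝒴 𝒳 : Type*}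

/-- `That` does not depend on the summation index, so it acts on the difference of the two means of
f. -/
lemma Shat_eq {n N : ℕ} (hn : 0 < n) (s : 𝒴 → 𝒳 → Vec d → Vec d) (f : 𝒳 → Vec d → Vec q) (γ : ℝ)
    (y : Fin n → 𝒴) (x : Fin n → 𝒳) (x' : Fin N → 𝒳) (θ : Vec d) :
    Shat s f γ y x x' θ = sampleMean (fun i => s (y i) (x i) θ) +
      γ • mulVec (That s f y x θ) (sampleMean (fun i => f (x i) θ) -
        sampleMean fun j => f (x' j) θ) := by
  have hn0 : (n : ℝ) ≠ 0 := by exact_mod_cast hn.ne'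
  have hsum : ∀ v : Fin n → Vec q, mulVec (That s f y x θ) (∑ i, v i) =
      ∑ i, mulVec (That s f y x θ) (v i) := by
    intro v
    ext a
    simp only [mulVec_apply, WithLp.ofLp_sum, Finset.sum_apply, Finset.mul_sum]
    exact Finset.sum_comm
  have e : sampleMean (fun i => f (x i) θ) - sampleMean (fun j => f (x' j) θ) =
      (n : ℝ)⁻¹ • ∑ i, (f (x i) θ - sampleMean fun j => f (x' j) θ) := by
    rw [Finset.sum_sub_distrib, smul_sub, Finset.sum_const, Finset.card_univ, Fintype.card_fin,
      ← Nat.cast_smul_eq_nsmul ℝ, smul_smul, inv_mul_cancel₀ hn0, one_smul]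
    rfl
  rw [e, mulVec_smul, hsum]
  simp only [Shat, sampleMean, Finset.sum_add_distrib, smul_add, ← Finset.smul_sum]
  rw [smul_comm]

variable [MeasurableSpace 𝒴] [MeasurableSpace 𝒳]

/-- Joint measurability of s and f in data and parameter is what permits substituting the random
`θ₀`. -/
lemma aemeasurable_thetaPDC {α : Type*} [MeasurableSpace α] {ρ : Measure α}
    {s : 𝒴 → 𝒳 → Vec d → Vec d} {f : 𝒳 → Vec d → Vec q}
    (hs : Measurable fun w : (𝒴 × 𝒳) × Vec d => s w.1.1 w.1.2 w.2)
    (hf : Measurable fun w : 𝒳 × Vec d => f w.1 w.2) (γ : ℝ) {n N : ℕ}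
    {Z : Fin n → α → 𝒴 × 𝒳} {x' : Fin N → α → 𝒳} (hZ : ∀ i, AEMeasurable (Z i) ρ)
    (hx' : ∀ j, AEMeasurable (x' j) ρ) {θ₀ : α → Vec d} (hθ₀ : AEMeasurable θ₀ ρ)
    {Hhat : α → Matrix (Fin d) (Fin d) ℝ} (hH : ∀ a b, AEMeasurable (fun ω => Hhat ω a b) ρ) :
    AEMeasurable (fun ω => thetaPDC s f γ (fun i => (Z i ω).1) (fun i => (Z i ω).2)
      (fun j => x' j ω) (θ₀ ω) (Hhat ω)) ρ := by
  have hsi : ∀ i, AEMeasurable (fun ω => s (Z i ω).1 (Z i ω).2 (θ₀ ω)) ρ := fun i =>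
    hs.comp_aemeasurable ((hZ i).prodMk hθ₀)
  have hfi : ∀ i, AEMeasurable (fun ω => f (Z i ω).2 (θ₀ ω)) ρ := fun i =>
    hf.comp_aemeasurable ((measurable_snd.comp_aemeasurable (hZ i)).prodMk hθ₀)
  have hfj : ∀ j, AEMeasurable (fun ω => f (x' j ω) (θ₀ ω)) ρ := fun j =>
    hf.comp_aemeasurable ((hx' j).prodMk hθ₀)
  refine hθ₀.sub (aemeasurable_mulVec (aemeasurable_matrix_inv hH)
    (aemeasurable_sampleMean fun i => (hsi i).add (AEMeasurable.const_smul ?_ γ)))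
  exact aemeasurable_mulVec
    (aemeasurable_matrix_mul (aemeasurable_sampleCov hsi hfi)
      (aemeasurable_matrix_inv (aemeasurable_sampleCov hfi hfi)))
    ((hfi i).sub (aemeasurable_sampleMean hfj))

end Estimators

/-! ### The asymptotic covariance as a function of γ. -/

section Gamma

variable {𝒴 𝒳 : Type*} [MeasurableSpace 𝒴] [MeasurableSpace 𝒳] {d q : ℕ}
  {P : Measure (𝒴 × 𝒳)} [IsProbabilityMeasure P]
  {s : 𝒴 → 𝒳 → Vec d → Vec d} {f : 𝒳 → Vec d → Vec q} {θs : Vec d}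

omit [IsProbabilityMeasure P] in
lemma covSF_transpose : (covSF P s f θs).transpose = covFS P s f θs := covMat_transpose _ _

omit [IsProbabilityMeasure P] in
lemma covF_transpose : (covF P f θs).transpose = covF P f θs := covMat_transpose _ _

omit [IsProbabilityMeasure P] in
lemma Gam_opt {η : ℝ} (hη : η ≠ 0) : Gam P s f θs η (-η) = covS P s θs -
    η • (covSF P s f θs * (covF P f θs)⁻¹ * covFS P s f θs) := by
  have e : (-η) ^ 2 / η + 2 * -η = -η := by field_simp; ring
  rw [Gam, e, neg_smul, sub_eq_add_neg]

omit [IsProbabilityMeasure P] in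
-- Completing the square: γ²/η + 2γ = (γ+η)²/η - η. This is the optimality of γ = -η.
lemma Gam_sub_Gam_opt {η : ℝ} (hη : η ≠ 0) (γ : ℝ) :
    Gam P s f θs η γ - Gam P s f θs η (-η) =
      ((γ + η) ^ 2 / η) • (covSF P s f θs * (covF P f θs)⁻¹ * covFS P s f θs) := by
  rw [Gam, Gam, add_sub_add_left_eq_sub, ← sub_smul]
  congr 1
  field_simp
  ring

/-- The explained part `Cov(s, f) Cov(f)⁻¹ Cov(f, s)` is positive semidefinite. -/
lemma explained_posSemidef (hf2 : MemLp (fun z : 𝒴 × 𝒳 => f z.2 θs) 2 P) :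
    (covSF P s f θs * (covF P f θs)⁻¹ * covFS P s f θs).PosSemidef := by
  have h : (covF P f θs).PosSemidef := covMat_posSemidef hf2
  have := h.inv.mul_mul_conjTranspose_same (covSF P s f θs)
  rwa [Matrix.conjTranspose_eq_transpose_of_trivial, covSF_transpose] at this

/-- The optimal quadratic form as the sum of the variances contributed by the two samples. -/
lemma dotProduct_Gam_opt (hfm : Measurable fun x => f x θs)
    (hs2 : MemLp (fun z : 𝒴 × 𝒳 => s z.1 z.2 θs) 2 P)
    (hf2 : MemLp (fun z : 𝒴 × 𝒳 => f z.2 θs) 2 P) (hcovF : IsUnit (covF P f θs))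
    {η : ℝ} (hη0 : 0 < η) (hη1 : η ≤ 1) (τ : Fin d → ℝ) (c : ℝ) :
    τ ⬝ᵥ (Gam P s f θs η (-η)).mulVec τ =
      Var[fun z : 𝒴 × 𝒳 => linComb τ (fun z : 𝒴 × 𝒳 => s z.1 z.2 θs) z - η *
        (linComb ((covSF P s f θs * (covF P f θs)⁻¹).transpose.mulVec τ) (fun x => f x θs) z.2
          - c); P] +
      Real.sqrt ((1 - η) / η) ^ 2 * Var[fun x => η *
        (linComb ((covSF P s f θs * (covF P f θs)⁻¹).transpose.mulVec τ) (fun x => f x θs) x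
          - c); P.snd] := by
  set w := (covSF P s f θs * (covF P f θs)⁻¹).transpose.mulVec τ with hw
  have hsnd : Var[fun x => η * (linComb w (fun x => f x θs) x - c); P.snd] =
      Var[fun z : 𝒴 × 𝒳 => η * (linComb w (fun z : 𝒴 × 𝒳 => f z.2 θs) z - c); P] := by
    have hlin : Measurable fun x => η * (linComb w (fun x => f x θs) x - c) :=
      ((measurable_linComb w hfm).sub_const c).const_mul η
    rw [Measure.snd, variance_map hlin.aemeasurable measurable_snd.aemeasurable]
    rfl
  have h1 := variance_linComb_sub τ w hs2 hf2 η c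
  have h2 := variance_const_mul_linComb_sub w hf2 η c
  have h3 := dotProduct_mulVec_regression (A := covSF P s f θs) (covF_transpose (P := P) (f := f)
    (θs := θs)) τ
  have h4 := dotProduct_mulVec_regression_self (A := covSF P s f θs)
    (covF_transpose (P := P) (f := f) (θs := θs)) hcovF τ
  rw [covSF_transpose, ← hw] at h3 h4
  rw [hsnd, h2, Real.sq_sqrt (div_nonneg (by linarith) hη0.le)]
  refine Eq.trans ?_ (congrArg (· + _) h1.symm)
  change _ = τ ⬝ᵥ (covS P s θs).mulVec τ - 2 * η * (τ ⬝ᵥ (covSF P s f θs).mulVec w) +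
        η ^ 2 * (w ⬝ᵥ (covF P f θs).mulVec w) +
        (1 - η) / η * (η ^ 2 * (w ⬝ᵥ (covF P f θs).mulVec w))
  -- All terms beyond Cov(s) are multiples of the explained part, with total coefficient -2η + η² +
  -- η(1-η) = -η.
  rw [h3, h4, Gam_opt hη0.ne', Matrix.sub_mulVec, Matrix.smul_mulVec, dotProduct_sub,
    dotProduct_smul, smul_eq_mul]
  field_simp
  ring

/-- As a difference of positive semidefinite matrices this is not immediate; it holds because the
quadratic form is a nonnegative combination of variances. -/
lemma Gam_opt_posSemidef (hfm : Measurable fun x => f x θs)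
    (hs2 : MemLp (fun z : 𝒴 × 𝒳 => s z.1 z.2 θs) 2 P)
    (hf2 : MemLp (fun z : 𝒴 × 𝒳 => f z.2 θs) 2 P) (hcovF : IsUnit (covF P f θs))
    {η : ℝ} (hη0 : 0 < η) (hη1 : η ≤ 1) : (Gam P s f θs η (-η)).PosSemidef := by
  refine Matrix.PosSemidef.of_dotProduct_mulVec_nonneg ?_ fun τ => ?_
  · have h1 : (covS P s θs).PosSemidef := covMat_posSemidef hs2
    rw [Gam_opt hη0.ne']
    refine h1.isHermitian.sub ?_
    have := (explained_posSemidef (s := s) hf2).smul hη0.le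
    exact this.isHermitian
  · rw [star_trivial, dotProduct_Gam_opt hfm hs2 hf2 hcovF hη0 hη1 τ 0]
    exact add_nonneg (variance_nonneg _ _) (mul_nonneg (sq_nonneg _) (variance_nonneg _ _))

end Gamma

/-! ### Asymptotic normality of the supervised and the de-correlated estimators. -/

section Main

lemma tendsto_matrix_of_norm_toEuclideanCLM {α : Type*} {F : Filter α} {k : ℕ}
    {A : α → Matrix (Fin k) (Fin k) ℝ} {A₀ : Matrix (Fin k) (Fin k) ℝ}
    (h : Tendsto (fun z => ‖Matrix.toEuclideanCLM (n := Fin k) (𝕜 := ℝ) (A z - A₀)‖) F (𝓝 0)) :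
    Tendsto A F (𝓝 A₀) := by
  refine tendsto_pi_nhds.2 fun a => tendsto_pi_nhds.2 fun b => ?_
  rw [tendsto_iff_norm_sub_tendsto_zero]
  refine squeeze_zero (fun _ => norm_nonneg _) (fun z => ?_) h
  have := abs_apply_le_norm_toEuclideanCLM (A z - A₀) a b
  rwa [Matrix.sub_apply, ← Real.norm_eq_abs] at this

lemma tendsto_matrix_mul {α : Type*} {F : Filter α} {k l r : ℕ}
    {A : α → Matrix (Fin k) (Fin l) ℝ} {A₀ : Matrix (Fin k) (Fin l) ℝ}
    {B : α → Matrix (Fin l) (Fin r) ℝ} {B₀ : Matrix (Fin l) (Fin r) ℝ}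
    (hA : Tendsto A F (𝓝 A₀)) (hB : Tendsto B F (𝓝 B₀)) :
    Tendsto (fun z => A z * B z) F (𝓝 (A₀ * B₀)) := by
  refine tendsto_pi_nhds.2 fun a => tendsto_pi_nhds.2 fun b => ?_
  simp only [Matrix.mul_apply]
  exact tendsto_finsetSum _ fun i _ => (tendsto_pi_nhds.1 (tendsto_pi_nhds.1 hA a) i).mul
    (tendsto_pi_nhds.1 (tendsto_pi_nhds.1 hB i) b)

lemma inv_sqrt_mul_sum_linComb {E : Type*} {k n : ℕ} (τ : Fin k → ℝ) (g : E → Vec k)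
    (ζ : Fin n → E) : (Real.sqrt n)⁻¹ * ∑ i, linComb τ g (ζ i) =
      ∑ b, τ b * (Real.sqrt (n : ℝ) • sampleMean fun i => g (ζ i)) b := by
  have e : (Real.sqrt (n : ℝ))⁻¹ = Real.sqrt n * (n : ℝ)⁻¹ := by
    rw [← div_eq_mul_inv, Real.sqrt_div_self]
  simp only [linComb, PiLp.smul_apply, smul_eq_mul, sampleMean_apply, e, Finset.mul_sum]
  rw [Finset.sum_comm]
  exact Finset.sum_congr rfl fun b _ => Finset.sum_congr rfl fun i _ => by ring

variable {𝒴 𝒳 : Type*} [MeasurableSpace 𝒴] [MeasurableSpace 𝒳] {d q : ℕ}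
  {P : Measure (𝒴 × 𝒳)} [IsProbabilityMeasure P]
  {s : 𝒴 → 𝒳 → Vec d → Vec d} {f : 𝒳 → Vec d → Vec q} {θs : Vec d}
  {Ω : ℕ → Type*} [∀ n, MeasurableSpace (Ω n)] {μ : ∀ n, Measure (Ω n)}
  [∀ n, IsProbabilityMeasure (μ n)]
  {N : ℕ → ℕ} {Z : ∀ n, Fin n → Ω n → 𝒴 × 𝒳} {x' : ∀ n, Fin (N n) → Ω n → 𝒳}
  {H : Matrix (Fin d) (Fin d) ℝ} {V : Set (Vec d)} {sdot : 𝒴 → 𝒳 → ℝ} {fdot : 𝒳 → ℝ}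

/-- Asymptotic normality of root-`n` consistent solutions of the estimating equation. -/
theorem asympNormal_supervised
    (hZ : IsIIDArray μ (fun n => n) Z P) (hx' : IsIIDArray μ N x' P.snd)
    (hind : ∀ n, IndepFun (fun ω i => Z n i ω) (fun ω j => x' n j ω) (μ n))
    (hN : Tendsto N atTop atTop)
    (hs : Measurable fun w : (𝒴 × 𝒳) × Vec d => s w.1.1 w.1.2 w.2)
    (hscore : ∫ z, s z.1 z.2 θs ∂P = 0)
    (hH : HasFDerivAt (fun θ => ∫ z, s z.1 z.2 θ ∂P)
      (Matrix.toEuclideanCLM (n := Fin d) (𝕜 := ℝ) H) θs) (hHunit : IsUnit H)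
    (hs2 : MemLp (fun z : 𝒴 × 𝒳 => s z.1 z.2 θs) 2 P) (hV : V ∈ 𝓝 θs)
    (hsdot : MemLp (fun z : 𝒴 × 𝒳 => sdot z.1 z.2) 2 P)
    (hsLip : ∀ y x, ∀ θ₁ ∈ V, ∀ θ₂ ∈ V, ‖s y x θ₁ - s y x θ₂‖ ≤ sdot y x * ‖θ₁ - θ₂‖)
    {θsup : ∀ n, Ω n → Vec d} (hmeas : ∀ n, Measurable (θsup n))
    (hθ : RootNConsistent μ θsup θs)
    (hroot : ∀ᶠ z : Σ n, Ω n in whp μ,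
      sampleMean (fun i => s (Z z.1 i z.2).1 (Z z.1 i z.2).2 (θsup z.1 z.2)) = 0) :
    AsympNormal μ θsup θs (sandwich H (covS P s θs)) := by
  have hd : IsUnit H.det := (Matrix.isUnit_iff_isUnit_det _).1 hHunit
  have hs2' : (covS P s θs).PosSemidef := covMat_posSemidef hs2
  have hsm : ∀ θ, Measurable fun z : 𝒴 × 𝒳 => s z.1 z.2 θ := fun θ =>
    hs.comp (measurable_id.prodMk measurable_const)
  have hexp := hZ.tendsto_score_expansion (g := fun z θ => s z.1 z.2 θ) hsm hs2 hsdot hV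
    (fun z => hsLip z.1 z.2) hH hθ
  refine asympNormal_of_linearization hZ hx' hind tendsto_id hN
    (sandwich_posSemidef H hs2') (fun n => (hmeas n).aemeasurable) fun t => ?_
  -- The supervised estimator is a degenerate two-sample case: the unlabeled sample enters with the
  -- zero function and weight 0.
  refine ⟨linComb (-(H⁻¹.transpose.mulVec t.ofLp)) fun z : 𝒴 × 𝒳 => s z.1 z.2 θs, 0, 0,
    measurable_linComb _ (hsm θs), measurable_const, memLp_linComb _ hs2, MemLp.zero,
    integral_linComb _ hs2 hscore, by simp, ?_, ?_⟩
  · rw [dotProduct_sandwich, ← covariance_self (memLp_linComb _ hs2).aemeasurable,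
      covariance_linComb _ _ hs2 hs2]
    simp [covS]
  · have h1 := (tendsto_mulVec (tendsto_const_nhds (x := H⁻¹)) hexp).inner (𝕜 := ℝ)
      (tendsto_const_nhds (x := t))
    rw [inner_zero_left] at h1
    have h2 := h1.neg
    rw [neg_zero] at h2
    refine h2.congr' ?_
    filter_upwards [hroot] with z hz
    rw [inv_sqrt_mul_sum_linComb, hz, toEuclideanCLM_eq_mulVec, smul_zero, zero_sub, mulVec_sub,
      mulVec_mulVec, Matrix.nonsing_inv_mul _ hd, one_mulVec, inner_sub_left, inner_mulVec]
    simp only [Pi.neg_apply, neg_mul, Finset.sum_neg_distrib, PiLp.neg_apply, mul_neg]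
    ring

/-- Consistency of the sample least squares coefficients. -/
lemma tendsto_That (hZ : IsIIDArray μ (fun n => n) Z P)
    (hs2 : MemLp (fun z : 𝒴 × 𝒳 => s z.1 z.2 θs) 2 P)
    (hf2 : MemLp (fun z : 𝒴 × 𝒳 => f z.2 θs) 2 P) (hcovF : IsUnit (covF P f θs))
    (hV : V ∈ 𝓝 θs) (hsdot : MemLp (fun z : 𝒴 × 𝒳 => sdot z.1 z.2) 2 P)
    (hfdot : MemLp (fun z : 𝒴 × 𝒳 => fdot z.2) 2 P)
    (hsLip : ∀ y x, ∀ θ₁ ∈ V, ∀ θ₂ ∈ V, ‖s y x θ₁ - s y x θ₂‖ ≤ sdot y x * ‖θ₁ - θ₂‖)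
    (hfLip : ∀ x, ∀ θ₁ ∈ V, ∀ θ₂ ∈ V, ‖f x θ₁ - f x θ₂‖ ≤ fdot x * ‖θ₁ - θ₂‖)
    {θ₀ : ∀ n, Ω n → Vec d}
    (hθ₀ : Tendsto (fun z : Σ n, Ω n => θ₀ z.1 z.2) (whp μ) (𝓝 θs)) :
    Tendsto (fun z : Σ n, Ω n => That s f (fun i => (Z z.1 i z.2).1)
      (fun i => (Z z.1 i z.2).2) (θ₀ z.1 z.2)) (whp μ)
      (𝓝 (covSF P s f θs * (covF P f θs)⁻¹)) := by
  have h1 := hZ.tendsto_sampleCov tendsto_id (u := fun z θ => s z.1 z.2 θ)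
    (v := fun z θ => f z.2 θ) hs2 hf2 hsdot hfdot hV (fun z => hsLip z.1 z.2)
    (fun z => hfLip z.2) hθ₀
  have h2 := hZ.tendsto_sampleCov tendsto_id (u := fun z θ => f z.2 θ)
    (v := fun z θ => f z.2 θ) hf2 hf2 hfdot hfdot hV (fun z => hfLip z.2)
    (fun z => hfLip z.2) hθ₀
  exact tendsto_matrix_mul h1 (tendsto_matrix_inv h2 hcovF)

/-- Asymptotic linearity of the one-step estimator. -/
lemma tendsto_thetaPDC_linearization
    (hZ : IsIIDArray μ (fun n => n) Z P) (hx' : IsIIDArray μ N x' P.snd)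
    (hs : ∀ θ, Measurable fun z : 𝒴 × 𝒳 => s z.1 z.2 θ) (hf : ∀ θ, Measurable fun x => f x θ)
    (hscore : ∫ z, s z.1 z.2 θs ∂P = 0)
    (hH : HasFDerivAt (fun θ => ∫ z, s z.1 z.2 θ ∂P)
      (Matrix.toEuclideanCLM (n := Fin d) (𝕜 := ℝ) H) θs) (hHunit : IsUnit H)
    (hs2 : MemLp (fun z : 𝒴 × 𝒳 => s z.1 z.2 θs) 2 P)
    (hf2 : MemLp (fun x => f x θs) 2 P.snd) (hcovF : IsUnit (covF P f θs))
    (hV : V ∈ 𝓝 θs) (hsdot : MemLp (fun z : 𝒴 × 𝒳 => sdot z.1 z.2) 2 P)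
    (hfdot : MemLp fdot 2 P.snd)
    (hsLip : ∀ y x, ∀ θ₁ ∈ V, ∀ θ₂ ∈ V, ‖s y x θ₁ - s y x θ₂‖ ≤ sdot y x * ‖θ₁ - θ₂‖)
    (hfLip : ∀ x, ∀ θ₁ ∈ V, ∀ θ₂ ∈ V, ‖f x θ₁ - f x θ₂‖ ≤ fdot x * ‖θ₁ - θ₂‖)
    (hNinf : Tendsto N atTop atTop)
    {r : ℝ} (hratio : Tendsto (fun n : ℕ => (n : ℝ) * (N n : ℝ)⁻¹) atTop (𝓝 r))
    {γ : ℕ → ℝ} {γ₀ : ℝ} (hγ : Tendsto γ atTop (𝓝 γ₀))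
    {θ₀ : ∀ n, Ω n → Vec d} (hθ₀ : RootNConsistent μ θ₀ θs)
    {Hhat : ∀ n, Ω n → Matrix (Fin d) (Fin d) ℝ}
    (hHhat : IsLittleOpOne μ fun n ω =>
      ‖Matrix.toEuclideanCLM (n := Fin d) (𝕜 := ℝ) (Hhat n ω - H)‖) :
    Tendsto (fun z : Σ n, Ω n => Real.sqrt z.1 •
      (thetaPDC s f (γ z.1) (fun i => (Z z.1 i z.2).1) (fun i => (Z z.1 i z.2).2)
        (fun j => x' z.1 j z.2) (θ₀ z.1 z.2) (Hhat z.1 z.2) - θs) +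
      mulVec H⁻¹ (Real.sqrt z.1 • sampleMean (fun i => s (Z z.1 i z.2).1 (Z z.1 i z.2).2 θs) +
        γ₀ • mulVec (covSF P s f θs * (covF P f θs)⁻¹)
          (Real.sqrt z.1 • (sampleMean (fun i => f (Z z.1 i z.2).2 θs) -
            sampleMean (fun j => f (x' z.1 j z.2) θs))))) (whp μ) (𝓝 0) := by
  have hd : IsUnit H.det := (Matrix.isUnit_iff_isUnit_det _).1 hHunit
  have hf2' : MemLp (fun z : 𝒴 × 𝒳 => f z.2 θs) 2 P :=
    hf2.comp_of_map measurable_snd.aemeasurable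
  have hfdot' : MemLp (fun z : 𝒴 × 𝒳 => fdot z.2) 2 P :=
    hfdot.comp_of_map measurable_snd.aemeasurable
  have hx : IsIIDArray μ (fun n => n) (fun n i ω => (Z n i ω).2) P.snd :=
    hZ.comp measurable_snd.aemeasurable
  have hAhat : Tendsto (fun z : Σ n, Ω n => (Hhat z.1 z.2)⁻¹) (whp μ) (𝓝 H⁻¹) := by
    have h0 := tendsto_whp_of_isLittleOpOne hHhat
    exact tendsto_matrix_inv (tendsto_matrix_of_norm_toEuclideanCLM h0) hHunit
  have hThat := tendsto_That hZ hs2 hf2' hcovF hV hsdot hfdot' hsLip hfLip hθ₀.tendsto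
  have hexp := hZ.tendsto_score_expansion (g := fun z θ => s z.1 z.2 θ) hs hs2 hsdot hV
    (fun z => hsLip z.1 z.2) hH hθ₀
  have hpred := tendsto_sampleMean_sub_sampleMean hx hx' hNinf hf hfdot hV hfLip hθ₀
  have hUb := hZ.bddP_sampleMean hs2 hscore
  have hBb := bddP_sampleMean_sub_sampleMean hx hx' hNinf hratio hf2
  have hAT := (hγ.comp (tendsto_fst_whp (μ := μ))).smul (tendsto_matrix_mul hAhat hThat)
  generalize covSF P s f θs * (covF P f θs)⁻¹ = T at *
  have h1 : Tendsto (fun z : Σ n, Ω n => 1 - (Hhat z.1 z.2)⁻¹ * H) (whp μ) (𝓝 0) := by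
    have h2 := (tendsto_matrix_mul hAhat (tendsto_const_nhds (x := H))).const_sub 1
    rwa [Matrix.nonsing_inv_mul _ hd, sub_self] at h2
  have h2 : Tendsto (fun z : Σ n, Ω n => (Hhat z.1 z.2)⁻¹ - H⁻¹) (whp μ) (𝓝 0) := by
    have := hAhat.sub_const H⁻¹
    rwa [sub_self] at this
  have h3 := hAT.sub_const (γ₀ • (H⁻¹ * T))
  rw [sub_self] at h3
  -- The exact remainder has five negligible pieces: Ĥ⁻¹ times the score expansion error, (1 - Ĥ⁻¹H)
  -- √n(θ̂₀ - θ*), the error of Ĥ⁻¹ acting on the score mean, γĤ⁻¹T̂ times the plug-in error of the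
  -- f-difference, and the error of γĤ⁻¹T̂ acting on that difference.
  have hrem := ((((tendsto_mulVec hAhat hexp).neg.add (hθ₀.bddP.tendsto_mulVec h1)).sub
    (hUb.tendsto_mulVec h2)).sub (tendsto_mulVec hAT hpred)).sub (hBb.tendsto_mulVec h3)
  simp only [neg_zero, add_zero, sub_zero] at hrem
  refine hrem.congr' ?_
  filter_upwards [tendsto_fst_whp.eventually_gt_atTop 0] with z hn
  simp only [thetaPDC, Shat_eq hn, Function.comp_apply, toEuclideanCLM_eq_mulVec]
  generalize That s f (fun i => (Z z.1 i z.2).1) (fun i => (Z z.1 i z.2).2) (θ₀ z.1 z.2) = That'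
  simp only [mulVec_add, mulVec_sub, mulVec_smul, sub_mulVec, smul_mulVec, one_mulVec,
    mulVec_mulVec, smul_sub, smul_add]
  module

/-- Asymptotic normality of the prediction de-correlated one-step estimator. -/
theorem asympNormal_thetaPDC
    (hZ : IsIIDArray μ (fun n => n) Z P) (hx' : IsIIDArray μ N x' P.snd)
    (hind : ∀ n, IndepFun (fun ω i => Z n i ω) (fun ω j => x' n j ω) (μ n))
    (hs : Measurable fun w : (𝒴 × 𝒳) × Vec d => s w.1.1 w.1.2 w.2)
    (hf : Measurable fun w : 𝒳 × Vec d => f w.1 w.2)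
    (hscore : ∫ z, s z.1 z.2 θs ∂P = 0)
    (hH : HasFDerivAt (fun θ => ∫ z, s z.1 z.2 θ ∂P)
      (Matrix.toEuclideanCLM (n := Fin d) (𝕜 := ℝ) H) θs) (hHunit : IsUnit H)
    (hs2 : MemLp (fun z : 𝒴 × 𝒳 => s z.1 z.2 θs) 2 P)
    (hf2 : MemLp (fun z : 𝒴 × 𝒳 => f z.2 θs) 2 P) (hcovF : IsUnit (covF P f θs))
    (hV : V ∈ 𝓝 θs) (hsdot : MemLp (fun z : 𝒴 × 𝒳 => sdot z.1 z.2) 2 P)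
    (hfdot : MemLp fdot 2 P.snd)
    (hsLip : ∀ y x, ∀ θ₁ ∈ V, ∀ θ₂ ∈ V, ‖s y x θ₁ - s y x θ₂‖ ≤ sdot y x * ‖θ₁ - θ₂‖)
    (hfLip : ∀ x, ∀ θ₁ ∈ V, ∀ θ₂ ∈ V, ‖f x θ₁ - f x θ₂‖ ≤ fdot x * ‖θ₁ - θ₂‖)
    {η : ℝ} (hη0 : 0 < η) (hη1 : η ≤ 1)
    (hN : Tendsto (fun n : ℕ => (N n : ℝ) / ((n : ℝ) + (N n : ℝ))) atTop (𝓝 η))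
    {θ₀ : ∀ n, Ω n → Vec d} (hθ₀meas : ∀ n, Measurable (θ₀ n))
    (hθ₀ : RootNConsistent μ θ₀ θs)
    {Hhat : ∀ n, Ω n → Matrix (Fin d) (Fin d) ℝ}
    (hHhatmeas : ∀ n a b, Measurable fun ω => Hhat n ω a b)
    (hHhat : IsLittleOpOne μ fun n ω =>
      ‖Matrix.toEuclideanCLM (n := Fin d) (𝕜 := ℝ) (Hhat n ω - H)‖) :
    AsympNormal μ
      (fun n ω => thetaPDC s f (-(N n : ℝ) / ((n : ℝ) + (N n : ℝ)))
        (fun i => (Z n i ω).1) (fun i => (Z n i ω).2) (fun j => x' n j ω) (θ₀ n ω) (Hhat n ω))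
      θs (sandwich H (Gam P s f θs η (-η))) := by
  have hNinf := tendsto_sampleSize_atTop hη0 hN
  have hratio := tendsto_sampleSize_ratio hη0 hN
  have hsm : ∀ θ, Measurable fun z : 𝒴 × 𝒳 => s z.1 z.2 θ := fun θ =>
    hs.comp (measurable_id.prodMk measurable_const)
  have hfm : ∀ θ, Measurable fun x : 𝒳 => f x θ := fun θ =>
    hf.comp (measurable_id.prodMk measurable_const)
  have hf2' : MemLp (fun x => f x θs) 2 P.snd :=
    (memLp_map_measure_iff (hfm θs).aestronglyMeasurable measurable_snd.aemeasurable).2 hf2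
  have hγ : Tendsto (fun n => -(N n : ℝ) / ((n : ℝ) + (N n : ℝ))) atTop (𝓝 (-η)) :=
    hN.neg.congr fun n => by rw [neg_div]
  have hlin := tendsto_thetaPDC_linearization hZ hx' hsm hfm hscore hH hHunit hs2 hf2' hcovF hV
    hsdot hfdot hsLip hfLip hNinf hratio hγ hθ₀ hHhat
  refine asympNormal_of_linearization hZ hx' hind tendsto_id hNinf
    (sandwich_posSemidef H (Gam_opt_posSemidef (hfm θs) hs2 hf2 hcovF hη0 hη1)) (fun n => ?_)
    fun t => ?_
  · exact aemeasurable_thetaPDC hs hf _ (fun i => (hZ.law n i).aemeasurable)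
      (fun j => (hx'.law n j).aemeasurable) (hθ₀meas n).aemeasurable
      fun a b => (hHhatmeas n a b).aemeasurable
  -- In direction t, τ collects the coefficients of s and w those of f; subtracting c centers wᵀf,
  -- since f itself need not have mean zero.
  set τ := -(H⁻¹.transpose.mulVec t.ofLp) with hτ
  set w := (covSF P s f θs * (covF P f θs)⁻¹).transpose.mulVec τ with hw
  set c := ∫ x, linComb w (fun x => f x θs) x ∂P.snd with hc
  have hls := memLp_linComb τ hs2
  have hlf' := memLp_linComb w hf2'
  have hmb : Measurable fun x => η * (linComb w (fun x => f x θs) x - c) :=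
    ((measurable_linComb w (hfm θs)).sub_const c).const_mul η
  have hLb : MemLp (fun x => η * (linComb w (fun x => f x θs) x - c)) 2 P.snd :=
    (hlf'.sub (memLp_const c)).const_mul η
  have hb0 : ∫ x, η * (linComb w (fun x => f x θs) x - c) ∂P.snd = 0 := by
    rw [integral_const_mul, integral_sub (hlf'.integrable (by norm_num)) (integrable_const _)]
    simp [← hc]
  have hLb' : MemLp (fun z : 𝒴 × 𝒳 => η * (linComb w (fun x => f x θs) z.2 - c)) 2 P :=
    hLb.comp_of_map measurable_snd.aemeasurable
  refine ⟨fun z => linComb τ (fun z : 𝒴 × 𝒳 => s z.1 z.2 θs) z -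
      η * (linComb w (fun x => f x θs) z.2 - c),
    fun x => η * (linComb w (fun x => f x θs) x - c), Real.sqrt ((1 - η) / η),
    (measurable_linComb τ (hsm θs)).sub (hmb.comp measurable_snd), hmb, hls.sub hLb', hLb,
    ?_, hb0, ?_, ?_⟩
  · rw [integral_sub (hls.integrable (by norm_num)) (hLb'.integrable (by norm_num)),
      integral_linComb τ hs2 hscore, zero_sub, neg_eq_zero, ← hb0, Measure.snd,
      integral_map measurable_snd.aemeasurable hmb.aestronglyMeasurable]
  · rw [dotProduct_sandwich]
    exact dotProduct_Gam_opt (hfm θs) hs2 hf2 hcovF hη0 hη1 τ c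
  · have h1 := hlin.inner (𝕜 := ℝ) (tendsto_const_nhds (x := t))
    rw [inner_zero_left] at h1
    have hY : BddP μ (fun z : Σ n, Ω n => (Real.sqrt (N z.1))⁻¹ *
        ∑ j, η * (linComb w (fun x => f x θs) (x' z.1 j z.2) - c)) := by
      have := hx'.bddP_centered_mean hNinf hLb (a := fun n => Real.sqrt (N n)) (C := 1) (by
        filter_upwards [hNinf.eventually_gt_atTop 0] with n hn
        have : (0 : ℝ) < N n := by exact_mod_cast hn
        rw [Real.sq_sqrt this.le, mul_inv_cancel₀ this.ne'])
      refine this.mono' (C := 1) zero_le_one (.of_forall fun z => le_of_eq ?_)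
      have e : (Real.sqrt (N z.1 : ℝ))⁻¹ = Real.sqrt (N z.1) * (N z.1 : ℝ)⁻¹ := by
        rw [← div_eq_mul_inv, Real.sqrt_div_self]
      rw [hb0, sub_zero, one_mul, e, mul_assoc]
    -- The unlabeled sum carries the weight √(n/N), while the two-sample limit requires a fixed
    -- weight. The discrepancy tends to zero and multiplies the bounded-in-probability sum `hY`.
    have hcn : Tendsto (fun z : Σ n, Ω n => |Real.sqrt ((z.1 : ℝ) * (N z.1 : ℝ)⁻¹) -
        Real.sqrt ((1 - η) / η)|) (whp μ) (𝓝 0) := by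
      have := ((hratio.sqrt.comp (tendsto_fst_whp (μ := μ))).sub_const
        (Real.sqrt ((1 - η) / η))).abs
      rwa [sub_self, abs_zero] at this
    have h2 : Tendsto (fun z : Σ n, Ω n => (Real.sqrt ((z.1 : ℝ) * (N z.1 : ℝ)⁻¹) -
        Real.sqrt ((1 - η) / η)) * ((Real.sqrt (N z.1))⁻¹ *
        ∑ j, η * (linComb w (fun x => f x θs) (x' z.1 j z.2) - c))) (whp μ) (𝓝 0) :=
      squeeze_zero_norm (fun z => (norm_mul _ _).le) (hY.tendsto_mul hcn)
    have h12 := h1.add h2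
    rw [add_zero] at h12
    refine h12.congr' ?_
    filter_upwards [tendsto_fst_whp.eventually_gt_atTop 0,
      (hNinf.comp tendsto_fst_whp).eventually_gt_atTop 0] with z hn hNz
    have hn0 : (0 : ℝ) < z.1 := by exact_mod_cast hn
    have hN0 : (0 : ℝ) < N z.1 := by exact_mod_cast hNz
    have hsn : Real.sqrt (z.1 : ℝ) ≠ 0 := (Real.sqrt_pos.2 hn0).ne'
    have hsN : Real.sqrt (N z.1 : ℝ) ≠ 0 := (Real.sqrt_pos.2 hN0).ne'
    have hqn := Real.mul_self_sqrt hn0.le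
    have hqN := Real.mul_self_sqrt hN0.le
    have eX : (Real.sqrt (z.1 : ℝ))⁻¹ * ∑ i, (linComb τ (fun z : 𝒴 × 𝒳 => s z.1 z.2 θs)
        (Z z.1 i z.2) - η * (linComb w (fun x => f x θs) (Z z.1 i z.2).2 - c)) =
        ∑ b, τ b * (Real.sqrt (z.1 : ℝ) • sampleMean fun i =>
          s (Z z.1 i z.2).1 (Z z.1 i z.2).2 θs) b -
        η * (∑ b, w b * (Real.sqrt (z.1 : ℝ) • sampleMean fun i => f (Z z.1 i z.2).2 θs) b -
          Real.sqrt (z.1 : ℝ) * c) := by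
      rw [← inv_sqrt_mul_sum_linComb w (fun x => f x θs) (fun i => (Z z.1 i z.2).2),
        ← inv_sqrt_mul_sum_linComb τ (fun z : 𝒴 × 𝒳 => s z.1 z.2 θs) (fun i => Z z.1 i z.2)]
      simp only [Finset.sum_sub_distrib, ← Finset.mul_sum, Finset.sum_const, Finset.card_univ,
        Fintype.card_fin, nsmul_eq_mul]
      have : Real.sqrt (z.1 : ℝ) * c = (Real.sqrt (z.1 : ℝ))⁻¹ * ((z.1 : ℝ) * c) := by
        rw [eq_inv_mul_iff_mul_eq₀ hsn, ← mul_assoc, hqn]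
      rw [this]
      ring
    -- Here √(n/N) · N^{-1/2} = √n/N restores the √n scale of the unlabeled mean; the centering term
    -- √n c is the one in `eX`, so the two cancel in the final sum.
    have eY : Real.sqrt ((z.1 : ℝ) * (N z.1 : ℝ)⁻¹) * ((Real.sqrt (N z.1))⁻¹ *
        ∑ j, η * (linComb w (fun x => f x θs) (x' z.1 j z.2) - c)) =
        η * (∑ b, w b * (Real.sqrt (z.1 : ℝ) • sampleMean fun j => f (x' z.1 j z.2) θs) b -
          Real.sqrt (z.1 : ℝ) * c) := by
      have h4 := inv_sqrt_mul_sum_linComb w (fun x => f x θs) (fun j => x' z.1 j z.2)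
      simp only [PiLp.smul_apply, smul_eq_mul, mul_left_comm _ (Real.sqrt _),
        ← Finset.mul_sum] at h4 ⊢
      rw [Finset.sum_sub_distrib, mul_left_comm _ η, mul_sub, h4, Real.sqrt_mul hn0.le,
        Real.sqrt_inv]
      simp only [Finset.sum_const, Finset.card_univ, Fintype.card_fin, nsmul_eq_mul]
      have e5 : (Real.sqrt (N z.1 : ℝ))⁻¹ * ((N z.1 : ℝ) * c) = Real.sqrt (N z.1 : ℝ) * c := by
        rw [inv_mul_eq_iff_eq_mul₀ hsN, ← mul_assoc, hqN]
      rw [e5]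
      field_simp
    have eB : (inner ℝ (mulVec H⁻¹ (Real.sqrt z.1 • sampleMean (fun i =>
          s (Z z.1 i z.2).1 (Z z.1 i z.2).2 θs) +
        (-η) • mulVec (covSF P s f θs * (covF P f θs)⁻¹)
          (Real.sqrt z.1 • (sampleMean (fun i => f (Z z.1 i z.2).2 θs) -
            sampleMean (fun j => f (x' z.1 j z.2) θs))))) t : ℝ) =
        -∑ b, τ b * (Real.sqrt (z.1 : ℝ) • sampleMean fun i =>
          s (Z z.1 i z.2).1 (Z z.1 i z.2).2 θs) b +
        η * (∑ b, w b * (Real.sqrt (z.1 : ℝ) • sampleMean fun i => f (Z z.1 i z.2).2 θs) b -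
          ∑ b, w b * (Real.sqrt (z.1 : ℝ) • sampleMean fun j => f (x' z.1 j z.2) θs) b) := by
      have ew : ((H⁻¹ * (covSF P s f θs * (covF P f θs)⁻¹)).transpose).mulVec t.ofLp = -w := by
        rw [hw, hτ, Matrix.mulVec_neg, neg_neg, Matrix.transpose_mul, Matrix.mulVec_mulVec]
      have eτ : H⁻¹.transpose.mulVec t.ofLp = -τ := by rw [hτ, neg_neg]
      rw [mulVec_add, mulVec_smul H⁻¹ (-η), mulVec_mulVec, inner_add_left, inner_smul_left, inner_mulVec,
        inner_mulVec, ew, eτ, smul_sub]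
      simp only [Pi.neg_apply, neg_mul, Finset.sum_neg_distrib, PiLp.sub_apply, mul_sub,
        Finset.sum_sub_distrib, map_neg, conj_trivial]
      ring
    rw [inner_add_left, eB, eX, sub_mul, eY]
    ring

end Main

end PDC

end

/-! ### The main theorem. -/

theorem corollary1
    {p d q : ℕ}
    -- the sample spaces of the label and of the covariates, and the population law of `(Y, X)`
    (𝒴 : Set ℝ) (𝒳 : Set (PDC.Vec p))
    (P : Measure (𝒴 × 𝒳)) [IsProbabilityMeasure P]
    -- the estimating function and the predictive estimating function
    (s : 𝒴 → 𝒳 → PDC.Vec d → PDC.Vec d) (f : 𝒳 → PDC.Vec d → PDC.Vec q)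
    (hs : Measurable fun w : (𝒴 × 𝒳) × PDC.Vec d => s w.1.1 w.1.2 w.2)
    (hf : Measurable fun w : 𝒳 × PDC.Vec d => f w.1 w.2)
    -- the target parameter
    (Θ : Set (PDC.Vec d)) (hΘ : IsCompact Θ)
    (θstar : PDC.Vec d) (hθ : θstar ∈ interior Θ)
    (hscore : ∫ z, s z.1 z.2 θstar ∂P = 0)
    -- the Jacobian matrix `H` of `θ ↦ E s(Y, X, θ)` at the target
    (H : Matrix (Fin d) (Fin d) ℝ)
    (hH : HasFDerivAt (fun θ => ∫ z, s z.1 z.2 θ ∂P)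
      (Matrix.toEuclideanCLM (n := Fin d) (𝕜 := ℝ) H) θstar)
    -- second moments and nonsingularity
    (hs2 : MemLp (fun z : 𝒴 × 𝒳 => s z.1 z.2 θstar) 2 P)
    (hf2 : MemLp (fun z : 𝒴 × 𝒳 => f z.2 θstar) 2 P)
    (hcovF : IsUnit (PDC.covF P f θstar)) (hHunit : IsUnit H)
    -- local Lipschitz conditions with square-integrable envelopes
    (V : Set (PDC.Vec d)) (hV : V ∈ 𝓝 θstar)
    (sdot : 𝒴 → 𝒳 → ℝ) (hsdot : MemLp (fun z : 𝒴 × 𝒳 => sdot z.1 z.2) 2 P)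
    (fdot : 𝒳 → ℝ) (hfdot : MemLp fdot 2 P.snd)
    (hsLip : ∀ y x, ∀ θ₁ ∈ V, ∀ θ₂ ∈ V, ‖s y x θ₁ - s y x θ₂‖ ≤ sdot y x * ‖θ₁ - θ₂‖)
    (hfLip : ∀ x, ∀ θ₁ ∈ V, ∀ θ₂ ∈ V, ‖f x θ₁ - f x θ₂‖ ≤ fdot x * ‖θ₁ - θ₂‖)
    -- the sample sizes: `n` labeled and `N n` unlabeled observations
    (N : ℕ → ℕ) (η : ℝ) (hη0 : 0 < η) (hη1 : η ≤ 1)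
    (hN : Tendsto (fun n : ℕ => (N n : ℝ) / ((n : ℝ) + (N n : ℝ))) atTop (𝓝 η))
    -- for each `n`, a labeled i.i.d. sample and an independent unlabeled i.i.d. sample
    {Ω : ℕ → Type*} [∀ n, MeasurableSpace (Ω n)]
    (μ : ∀ n, Measure (Ω n)) [∀ n, IsProbabilityMeasure (μ n)]
    (y : ∀ n, Fin n → Ω n → 𝒴) (x : ∀ n, Fin n → Ω n → 𝒳)
    (x' : ∀ n, Fin (N n) → Ω n → 𝒳)
    (hlawL : ∀ n i, HasLaw (fun ω => (y n i ω, x n i ω)) P (μ n))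
    (hlawU : ∀ n j, HasLaw (x' n j) P.snd (μ n))
    (hindL : ∀ n, iIndepFun (fun i ω => (y n i ω, x n i ω)) (μ n))
    (hindU : ∀ n, iIndepFun (x' n) (μ n))
    (hindLU : ∀ n, IndepFun (fun ω i => (y n i ω, x n i ω)) (fun ω j => x' n j ω) (μ n))
    -- the initial estimator and the estimator of `H`
    (θ₀ : ∀ n, Ω n → PDC.Vec d) (hθ₀meas : ∀ n, Measurable (θ₀ n))
    (hθ₀ : PDC.RootNConsistent μ θ₀ θstar)
    (Hhat : ∀ n, Ω n → Matrix (Fin d) (Fin d) ℝ)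
    (hHhatmeas : ∀ n a b, Measurable fun ω => Hhat n ω a b)
    (hHhat : PDC.IsLittleOpOne μ fun n ω =>
      ‖Matrix.toEuclideanCLM (n := Fin d) (𝕜 := ℝ) (Hhat n ω - H)‖) :
    -- asymptotic normality with the data-driven choice `γ = -N / (n + N)`
    PDC.AsympNormal μ
      (fun n ω => PDC.thetaPDC s f (-(N n : ℝ) / ((n : ℝ) + (N n : ℝ)))
        (fun i => y n i ω) (fun i => x n i ω) (fun j => x' n j ω) (θ₀ n ω) (Hhat n ω))
      θstar (PDC.sandwich H (PDC.Gam P s f θstar η (-η))) ∧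
    -- the value of `Γ` at `γ_opt = -η`
    PDC.Gam P s f θstar η (-η) = PDC.covS P s θstar -
      η • (PDC.covSF P s f θstar * (PDC.covF P f θstar)⁻¹ * PDC.covFS P s f θstar) ∧
    -- `γ_opt = -η` is optimal: it minimizes the asymptotic covariance matrix over all `γ`
    (∀ γ : ℝ, (PDC.sandwich H (PDC.Gam P s f θstar η γ) -
      PDC.sandwich H (PDC.Gam P s f θstar η (-η))).PosSemidef) ∧
    -- every root-n consistent supervised estimator has asymptotic covariance `H⁻¹ Cov(s) H⁻ᵀ`
    (∀ θsup : ∀ n, Ω n → PDC.Vec d, (∀ n, Measurable (θsup n)) →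
      PDC.RootNConsistent μ θsup θstar →
      Tendsto (fun n => μ n {ω | PDC.sampleMean
        (fun i => s (y n i ω) (x n i ω) (θsup n ω)) ≠ 0}) atTop (𝓝 0) →
      PDC.AsympNormal μ θsup θstar (PDC.sandwich H (PDC.covS P s θstar))) ∧
    -- and this is never smaller than that of the prediction de-correlated estimator
    (PDC.sandwich H (PDC.covS P s θstar) -
      PDC.sandwich H (PDC.Gam P s f θstar η (-η))).PosSemidef := by
  have hZ : PDC.IsIIDArray μ (fun n => n) (fun n i ω => (y n i ω, x n i ω)) P := ⟨hlawL, hindL⟩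
  have hx' : PDC.IsIIDArray μ N x' P.snd := ⟨hlawU, hindU⟩
  have hfθ : Measurable fun x => f x θstar := hf.comp (measurable_id.prodMk measurable_const)
  have hexpl := PDC.explained_posSemidef (s := s) hf2
  refine ⟨PDC.asympNormal_thetaPDC hZ hx' hindLU hs hf hscore hH hHunit hs2 hf2 hcovF hV hsdot
    hfdot hsLip hfLip hη0 hη1 hN hθ₀meas hθ₀ hHhatmeas hHhat, PDC.Gam_opt hη0.ne', fun γ => ?_,
    fun θsup hmeas hθsup hroot => ?_, ?_⟩
  · rw [PDC.sandwich_sub, PDC.Gam_sub_Gam_opt hη0.ne']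
    exact PDC.sandwich_posSemidef H (hexpl.smul (div_nonneg (sq_nonneg _) hη0.le))
  · refine PDC.asympNormal_supervised hZ hx' hindLU (PDC.tendsto_sampleSize_atTop hη0 hN) hs hscore
      hH hHunit hs2 hV hsdot hsLip hmeas hθsup (PDC.mem_whp.2 hroot)
  -- The efficiency gain over the supervised estimator is the sandwich of η times the explained
  -- part.
  · rw [PDC.sandwich_sub, PDC.Gam_opt hη0.ne', sub_sub_cancel]
    exact PDC.sandwich_posSemidef H (hexpl.smul hη0.le)
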